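/- **Higher Auslander–Reiten duality.** Let $d\ge 1$ be an integer, let $R$ be a commutative artinian ring and $\Lambda$ an Artin $R$-algebra (an $R$-algebra that is finitely generated as an $R$-module). Let $\operatorname{mod}\Lambda$ be the category of finitely generated right $\Lambda$-modules, let $I$ be an injective envelope of $S_1\oplus\dots\oplus S_n$, where $S_1,\dots,S_n$ is a complete set of representatives of the isomorphism classes of simple $R$-modules, and let $D=\operatorname{Hom}_R(-,I)$. Write $\underline{\operatorname{mod}}\,\Lambda$ (resp. $\overline{\operatorname{mod}}\,\Lambda$) for the category with the same objects as $\operatorname{mod}\Lambda$ and with morphisms $\underline{\operatorname{Hom}}_\Lambda(X,Y)$ (resp. $\overline{\operatorname{Hom}}_\Lambda(X,Y)$) given by the $\Lambda$-homomorphisms modulo those that factor through a projective (resp. injective) module. Let $\Omega\colon\underline{\operatorname{mod}}\,\Lambda\to\underline{\operatorname{mod}}\,\Lambda$ be the syzygy functor, let $\operatorname{Tr}$ be the transpose, $\operatorname{Tr}X=\operatorname{Coker}(\operatorname{Hom}_\Lambda(P_0,\Lambda)\to\operatorname{Hom}_\Lambda(P_1,\Lambda))$ for a projective presentation $P_1\to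 P_0\to X\to 0$, and let $$\tau_d:=D\operatorname{Tr}\Omega^{d-1}\colon\underline{\operatorname{mod}}\,\Lambda\to\overline{\operatorname{mod}}\,\Lambda .$$ Let $\mathcal M$ be a $d$-cluster-tilting subcategory of $\operatorname{mod}\Lambda$, that is, a full subcategory closed under direct sums and direct summands which is functorially finite and satisfies $$\mathcal M=\{X\mid \operatorname{Ext}^k_\Lambda(X,\mathcal M)=0\text{ for }0<k<d\}=\{Y\mid \operatorname{Ext}^k_\Lambda(\mathcal M,Y)=0\text{ for }0<k<d\},$$ and let $\underline{\mathcal M}$ be the full subcategory of $\underline{\operatorname{mod}}\,\Lambda$ on the objects of $\mathcal M$. Then there is an isomorphism of $R$-modules $$D\,\underline{\operatorname{Hom}}_\Lambda(X,Y)\;\cong\;\operatorname{Ext}^d_\Lambda(Y,\tau_dX)$$ which is natural in $X\in\underline{\mathcal M}$ and $Y\in\underline{\mathcal M}$; that is, the two sides are isomorphic as functors from $\underline{\mathcal M}\times\underline{\mathcal M}^{\mathrm{op}}$ to $R$-modules. -/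

import Mathlib

open CategoryTheory CategoryTheory.Limits CategoryTheory.Abelian Opposite
open scoped ZeroObject

universe w v u t

set_option linter.unusedSectionVars false
set_option linter.unusedVariables false
set_option linter.unusedTactic false

noncomputable section

namespace HigherAR

/-! ### Stable categories of an abelian category -/

section Stable

variable (C : Type u) [Category.{v} C] [Abelian C]

/-- Two parallel morphisms are identified in the projectively stable category when their
difference factors through a projective object. -/
def projRel : HomRel C := fun X Y f g =>
  ∃ (P : C) (_ : Projective P) (a : X ⟶ P) (b : P ⟶ Y), f - g = a ≫ b

/-- Two parallel morphisms are identified in the injectively stable category when their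
difference factors through an injective object. -/
def injRel : HomRel C := fun X Y f g =>
  ∃ (J : C) (_ : Injective J) (a : X ⟶ J) (b : J ⟶ Y), f - g = a ≫ b

variable {C}

theorem projRel_add {X Y : C} (f₁ f₂ g₁ g₂ : X ⟶ Y) (hf : projRel C f₁ f₂)
    (hg : projRel C g₁ g₂) : projRel C (f₁ + g₁) (f₂ + g₂) := by
  obtain ⟨P, hP, a, b, h⟩ := hf
  obtain ⟨Q, hQ, c, e, k⟩ := hg
  refine ⟨P ⊞ Q, inferInstance, biprod.lift a c, biprod.desc b e, ?_⟩
  rw [biprod.lift_desc, ← h, ← k]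
  abel

theorem injRel_add {X Y : C} (f₁ f₂ g₁ g₂ : X ⟶ Y) (hf : injRel C f₁ f₂)
    (hg : injRel C g₁ g₂) : injRel C (f₁ + g₁) (f₂ + g₂) := by
  obtain ⟨P, hP, a, b, h⟩ := hf
  obtain ⟨Q, hQ, c, e, k⟩ := hg
  refine ⟨P ⊞ Q, inferInstance, biprod.lift a c, biprod.desc b e, ?_⟩
  rw [biprod.lift_desc, ← h, ← k]
  abel

instance : Congruence (projRel C) where
  equivalence :=
    { refl := fun f => ⟨(0 : C), inferInstance, 0, 0, by simp⟩
      symm := by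
        rintro f g ⟨P, hP, a, b, h⟩
        exact ⟨P, hP, -a, b, by rw [Preadditive.neg_comp, ← h, neg_sub]⟩
      trans := by
        intro f g k h₁ h₂
        obtain ⟨P, hP, a, b, h⟩ := projRel_add _ _ _ _ h₁ h₂
        exact ⟨P, hP, a, b, by rw [← h]; abel⟩ }
  comp_left := by
    rintro X Y Z f g g' ⟨P, hP, a, b, h⟩
    exact ⟨P, hP, f ≫ a, b, by rw [Category.assoc, ← h, Preadditive.comp_sub]⟩
  comp_right := by
    rintro X Y Z f f' g ⟨P, hP, a, b, h⟩
    exact ⟨P, hP, a, b ≫ g, by rw [← Category.assoc, ← h, Preadditive.sub_comp]⟩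

instance : Congruence (injRel C) where
  equivalence :=
    { refl := fun f => ⟨(0 : C), inferInstance, 0, 0, by simp⟩
      symm := by
        rintro f g ⟨P, hP, a, b, h⟩
        exact ⟨P, hP, -a, b, by rw [Preadditive.neg_comp, ← h, neg_sub]⟩
      trans := by
        intro f g k h₁ h₂
        obtain ⟨P, hP, a, b, h⟩ := injRel_add _ _ _ _ h₁ h₂
        exact ⟨P, hP, a, b, by rw [← h]; abel⟩ }
  comp_left := by
    rintro X Y Z f g g' ⟨P, hP, a, b, h⟩
    exact ⟨P, hP, f ≫ a, b, by rw [Category.assoc, ← h, Preadditive.comp_sub]⟩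
  comp_right := by
    rintro X Y Z f f' g ⟨P, hP, a, b, h⟩
    exact ⟨P, hP, a, b ≫ g, by rw [← Category.assoc, ← h, Preadditive.sub_comp]⟩

variable (C)

/-- The projectively stable category of `C`: same objects, morphisms modulo those that factor
through a projective object. -/
abbrev ProjStable := CategoryTheory.Quotient (projRel C)

/-- The injectively stable category of `C`: same objects, morphisms modulo those that factor
through an injective object. -/
abbrev InjStable := CategoryTheory.Quotient (injRel C)

instance : Preadditive (ProjStable C) :=
  CategoryTheory.Quotient.preadditive (projRel C) (fun _ _ => projRel_add)

instance : (CategoryTheory.Quotient.functor (projRel C)).Additive :=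
  CategoryTheory.Quotient.functor_additive (projRel C) (fun _ _ => projRel_add)

theorem projRel_smul (R : Type t) [Ring R] [Linear R C] (r : R) ⦃X Y : C⦄ (f g : X ⟶ Y)
    (h : projRel C f g) : projRel C (r • f) (r • g) := by
  obtain ⟨P, hP, a, b, h⟩ := h
  exact ⟨P, hP, r • a, b, by rw [Linear.smul_comp, ← h, smul_sub]⟩

instance (R : Type t) [Ring R] [Linear R C] : Linear R (ProjStable C) :=
  CategoryTheory.Quotient.linear R (projRel C) (projRel_smul C R)

end Stable

section Syzygy

variable {C : Type u} [Category.{v} C] [Abelian C] [EnoughProjectives C]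

/-- The syzygy of `X`: the kernel of a chosen epimorphism `Projective.over X ⟶ X` with
projective source. -/
def syz (X : C) : C := kernel (Projective.π X)

/-- The inclusion of the syzygy into the chosen projective. -/
def syzι (X : C) : syz X ⟶ Projective.over X := kernel.ι (Projective.π X)

theorem syzι_π (X : C) : syzι X ≫ Projective.π X = 0 := kernel.condition _

instance (X : C) : Mono (syzι X) := inferInstanceAs (Mono (kernel.ι (Projective.π X)))

/-- A morphism into the chosen projective that is killed by the projection comes from the
syzygy. -/
theorem exists_syz_fac {W Y : C} (m : W ⟶ Projective.over Y) (h : m ≫ Projective.π Y = 0) :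
    ∃ s : W ⟶ syz Y, m = s ≫ syzι Y :=
  ⟨kernel.lift _ m h, (kernel.lift_ι _ _ _).symm⟩

/-- A chosen lift of `f` to the projectives. -/
def lift₀ {X Y : C} (f : X ⟶ Y) : Projective.over X ⟶ Projective.over Y :=
  Projective.factorThru (Projective.π X ≫ f) (Projective.π Y)

theorem lift₀_π {X Y : C} (f : X ⟶ Y) :
    lift₀ f ≫ Projective.π Y = Projective.π X ≫ f :=
  Projective.factorThru_comp _ _

/-- The morphism between syzygies obtained by restricting the chosen lift of `f`. -/
def syzMap {X Y : C} (f : X ⟶ Y) : syz X ⟶ syz Y :=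
  kernel.lift _ (syzι X ≫ lift₀ f) (by
    rw [Category.assoc, lift₀_π, ← Category.assoc, syzι_π, zero_comp])

theorem syzMap_ι {X Y : C} (f : X ⟶ Y) : syzMap f ≫ syzι Y = syzι X ≫ lift₀ f :=
  kernel.lift_ι _ _ _

/-- Lifts of stably equal morphisms differ, up to a morphism that factors through the
projection, by a morphism into the syzygy. -/
theorem exists_lift_sub {X Y : C} {f f' : X ⟶ Y} (hff : projRel C f f')
    {l l' : Projective.over X ⟶ Projective.over Y}
    (hl : l ≫ Projective.π Y = Projective.π X ≫ f)
    (hl' : l' ≫ Projective.π Y = Projective.π X ≫ f') :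
    ∃ (c : X ⟶ Projective.over Y) (s : Projective.over X ⟶ syz Y),
      l - l' = Projective.π X ≫ c + s ≫ syzι Y := by
  obtain ⟨Q, hQ, a, b, h⟩ := hff
  obtain ⟨s, hs⟩ := exists_syz_fac
    (l - l' - Projective.π X ≫ a ≫ Projective.factorThru b (Projective.π Y)) (by
      simp only [Preadditive.sub_comp, Category.assoc, hl, hl', Projective.factorThru_comp,
        ← h, Preadditive.comp_sub, sub_self])
  exact ⟨a ≫ Projective.factorThru b (Projective.π Y), s, by rw [← hs]; abel⟩

theorem projRel_syz {X Y : C} {f f' : X ⟶ Y} (hff : projRel C f f')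
    {l l' : Projective.over X ⟶ Projective.over Y}
    (hl : l ≫ Projective.π Y = Projective.π X ≫ f)
    (hl' : l' ≫ Projective.π Y = Projective.π X ≫ f')
    {g g' : syz X ⟶ syz Y} (hg : g ≫ syzι Y = syzι X ≫ l)
    (hg' : g' ≫ syzι Y = syzι X ≫ l') : projRel C g g' := by
  obtain ⟨c, s, h⟩ := exists_lift_sub hff hl hl'
  refine ⟨Projective.over X, inferInstance, syzι X, s, ?_⟩
  rw [← cancel_mono (syzι Y), Preadditive.sub_comp, hg, hg', ← Preadditive.comp_sub, h,
    Preadditive.comp_add, ← Category.assoc, syzι_π, zero_comp, zero_add, Category.assoc]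

variable (C)

/-- Heller's syzygy functor on the projectively stable category. -/
def syzygyFunctor : ProjStable C ⥤ ProjStable C :=
  CategoryTheory.Quotient.lift (projRel C)
    { obj := fun X => (CategoryTheory.Quotient.functor (projRel C)).obj (syz X)
      map := fun f => (CategoryTheory.Quotient.functor (projRel C)).map (syzMap f)
      map_id := fun X => by
        rw [← CategoryTheory.Functor.map_id]
        exact CategoryTheory.Quotient.sound _ (projRel_syz (Congruence.equivalence.refl (𝟙 X))
          (lift₀_π (𝟙 X)) (l' := 𝟙 _) (by simp) (syzMap_ι _) (by simp))
      map_comp := fun {X Y Z} f g => by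
        rw [← CategoryTheory.Functor.map_comp]
        exact CategoryTheory.Quotient.sound _ (projRel_syz (Congruence.equivalence.refl (f ≫ g))
          (lift₀_π (f ≫ g)) (l' := lift₀ f ≫ lift₀ g)
          (by rw [Category.assoc, lift₀_π, ← Category.assoc, lift₀_π, Category.assoc])
          (syzMap_ι _)
          (by rw [Category.assoc, syzMap_ι, ← Category.assoc, syzMap_ι, Category.assoc])) }
    (fun _ _ f f' h => CategoryTheory.Quotient.sound _
      (projRel_syz h (lift₀_π f) (lift₀_π f') (syzMap_ι f) (syzMap_ι f')))

/-- The `n`-fold iterate of the syzygy functor. -/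
def iteratedSyzygy : ℕ → (ProjStable C ⥤ ProjStable C)
  | 0 => 𝟭 _
  | n + 1 => iteratedSyzygy n ⋙ syzygyFunctor C

end Syzygy

section Transpose

variable {C : Type u} [Category.{v} C] [Abelian C] [EnoughProjectives C]

/-- The differential `P₁ ⟶ P₀` of the projective presentation of `X` formed by the chosen
projectives over `X` and over its syzygy. -/
def presD (X : C) : Projective.over (syz X) ⟶ Projective.over X :=
  Projective.π (syz X) ≫ syzι X

theorem presD_π (X : C) : presD X ≫ Projective.π X = 0 := by
  rw [presD, Category.assoc, syzι_π, comp_zero]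

/-- The chosen lift of `f` in degree one of the presentations. -/
def lift₁ {X Y : C} (f : X ⟶ Y) :
    Projective.over (syz X) ⟶ Projective.over (syz Y) := lift₀ (syzMap f)

theorem lift₁_presD {X Y : C} (f : X ⟶ Y) : lift₁ f ≫ presD Y = presD X ≫ lift₀ f := by
  rw [presD, lift₁, ← Category.assoc, lift₀_π, Category.assoc, syzMap_ι, presD,
    Category.assoc]

variable {D : Type w} [Category.{t} D] [Abelian D] (F : Cᵒᵖ ⥤ D) [F.Additive]

/-- The transpose of `X` with respect to a contravariant functor `F`: the cokernel of
`F(P₀) ⟶ F(P₁)`, where `P₁ ⟶ P₀ ⟶ X ⟶ 0` is the chosen projective presentation. -/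
def transposeObj (X : C) : D := cokernel (F.map (presD X).op)

/-- The projection `F(P₁) ⟶ transposeObj F X`. -/
def transposeπ (X : C) : F.obj (op (Projective.over (syz X))) ⟶ transposeObj F X :=
  cokernel.π (F.map (presD X).op)

instance (X : C) : Epi (transposeπ F X) :=
  inferInstanceAs (Epi (cokernel.π (F.map (presD X).op)))

theorem map_presD_transposeπ (X : C) : F.map (presD X).op ≫ transposeπ F X = 0 :=
  cokernel.condition _

theorem map_lift₁_transposeπ {X Y : C} (f : X ⟶ Y) :
    F.map (presD Y).op ≫ F.map (lift₁ f).op ≫ transposeπ F X = 0 := by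
  rw [← Category.assoc, ← F.map_comp, ← op_comp, lift₁_presD, op_comp, F.map_comp,
    Category.assoc, map_presD_transposeπ, comp_zero]

/-- The morphism between transposes that is induced by the chosen lift of `f`. -/
def transposeMap {X Y : C} (f : X ⟶ Y) : transposeObj F Y ⟶ transposeObj F X :=
  cokernel.desc _ (F.map (lift₁ f).op ≫ transposeπ F X) (map_lift₁_transposeπ F f)

theorem π_transposeMap {X Y : C} (f : X ⟶ Y) :
    transposeπ F Y ≫ transposeMap F f = F.map (lift₁ f).op ≫ transposeπ F X :=
  cokernel.π_desc _ _ _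

theorem projRel_transpose (hF : ∀ P : C, Projective P → Projective (F.obj (op P)))
    {X Y : C} {f f' : X ⟶ Y} (hff : projRel C f f')
    {l l' : Projective.over X ⟶ Projective.over Y}
    (hl : l ≫ Projective.π Y = Projective.π X ≫ f)
    (hl' : l' ≫ Projective.π Y = Projective.π X ≫ f')
    {k k' : Projective.over (syz X) ⟶ Projective.over (syz Y)}
    (hk : k ≫ presD Y = presD X ≫ l) (hk' : k' ≫ presD Y = presD X ≫ l')
    {g g' : transposeObj F Y ⟶ transposeObj F X}
    (hg : transposeπ F Y ≫ g = F.map k.op ≫ transposeπ F X)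
    (hg' : transposeπ F Y ≫ g' = F.map k'.op ≫ transposeπ F X) : projRel D g g' := by
  obtain ⟨c, s, h⟩ := exists_lift_sub hff hl hl'
  let σ := Projective.factorThru s (Projective.π (syz Y))
  have hσ : σ ≫ presD Y = s ≫ syzι Y := by
    rw [presD, ← Category.assoc, Projective.factorThru_comp]
  let n := k - k' - presD X ≫ σ
  have hn : n ≫ presD Y = 0 := by
    simp only [n, Preadditive.sub_comp, hk, hk', Category.assoc, hσ]
    rw [← Preadditive.comp_sub, ← Preadditive.comp_sub, h, add_sub_cancel_right,
      ← Category.assoc, presD_π, zero_comp]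
  have hn' : F.map (presD Y).op ≫ F.map n.op = 0 := by
    rw [← F.map_comp, ← op_comp, hn, op_zero, F.map_zero]
  have hkn : F.map k.op - F.map k'.op = F.map n.op + F.map σ.op ≫ F.map (presD X).op := by
    rw [← F.map_comp, ← op_comp, ← F.map_add, ← F.map_sub, ← op_add, ← op_sub]
    simp [n]
  refine ⟨F.obj (op (Projective.over (syz X))), hF _ inferInstance,
    cokernel.desc _ (F.map n.op) hn', transposeπ F X, ?_⟩
  rw [← cancel_epi (transposeπ F Y), Preadditive.comp_sub, hg, hg', ← Preadditive.sub_comp, hkn,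
    Preadditive.add_comp, Category.assoc, map_presD_transposeπ, comp_zero, add_zero]
  exact (by rw [cokernel.π_desc_assoc] :
    F.map n.op ≫ transposeπ F X = cokernel.π (F.map (presD Y).op) ≫
      cokernel.desc _ (F.map n.op) hn' ≫ transposeπ F X)

/-- The transpose as a contravariant functor between projectively stable categories, for a
contravariant additive functor `F` that sends projectives to projectives. -/
def transposeFunctor (hF : ∀ P : C, Projective P → Projective (F.obj (op P))) :
    ProjStable C ⥤ (ProjStable D)ᵒᵖ :=
  CategoryTheory.Quotient.lift (projRel C)
    { obj := fun X => op ((CategoryTheory.Quotient.functor (projRel D)).obj (transposeObj F X))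
      map := fun f => ((CategoryTheory.Quotient.functor (projRel D)).map (transposeMap F f)).op
      map_id := fun X => by
        rw [← op_id, ← CategoryTheory.Functor.map_id]
        congr 1
        exact CategoryTheory.Quotient.sound _ (projRel_transpose F hF (Congruence.equivalence.refl (𝟙 X))
          (lift₀_π (𝟙 X)) (l' := 𝟙 _) (by simp) (lift₁_presD _) (k' := 𝟙 _) (by simp)
          (π_transposeMap F _) (by simp))
      map_comp := fun {X Y Z} f g => by
        rw [← op_comp, ← CategoryTheory.Functor.map_comp]
        congr 1
        exact CategoryTheory.Quotient.sound _ (projRel_transpose F hF (Congruence.equivalence.refl (f ≫ g))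
          (lift₀_π (f ≫ g)) (l' := lift₀ f ≫ lift₀ g)
          (by rw [Category.assoc, lift₀_π, ← Category.assoc, lift₀_π, Category.assoc])
          (lift₁_presD _) (k' := lift₁ f ≫ lift₁ g)
          (by rw [Category.assoc, lift₁_presD, ← Category.assoc, lift₁_presD, Category.assoc])
          (π_transposeMap F _)
          (by rw [← Category.assoc, π_transposeMap, Category.assoc, π_transposeMap,
                ← Category.assoc, ← F.map_comp, ← op_comp])) }
    (fun _ _ f f' h => congrArg Quiver.Hom.op (CategoryTheory.Quotient.sound _
      (projRel_transpose F hF h (lift₀_π f) (lift₀_π f')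
        (lift₁_presD f) (lift₁_presD f') (π_transposeMap F f) (π_transposeMap F f'))))

end Transpose

section Duality

variable {C : Type u} [Category.{v} C] [Abelian C] {D : Type w} [Category.{t} D] [Abelian D]

/-- A contravariant additive functor that sends projectives to injectives induces a functor from
the projectively stable to the injectively stable category. -/
def dualityStable (G : Dᵒᵖ ⥤ C) [G.Additive]
    (hG : ∀ P : D, Projective P → Injective (G.obj (op P))) : (ProjStable D)ᵒᵖ ⥤ InjStable C :=
  (CategoryTheory.Quotient.lift (projRel D) (G.rightOp ⋙ (CategoryTheory.Quotient.functor (injRel C)).op)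
    (by
      rintro X Y f f' ⟨P, hP, a, b, h⟩
      refine Quiver.Hom.unop_inj (CategoryTheory.Quotient.sound _ ⟨G.obj (op P), hG P hP, G.map b.op,
        G.map a.op, ?_⟩)
      rw [← G.map_comp, ← op_comp, ← h, op_sub, G.map_sub]
      rfl)).leftOp

end Duality

section Ext

variable (C : Type u) [Category.{v} C] [Abelian C] [HasExt.{w} C]
  (R : Type t) [CommRing R] [Linear R C]

/-- The functor `Extⁿ(X, -)` with values in `R`-modules. -/
def extObj (n : ℕ) (X : C) : C ⥤ ModuleCat.{w} R where
  obj Y := ModuleCat.of R (Ext.{w} X Y n)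
  map g := ModuleCat.ofHom ((Ext.mk₀ g).postcompOfLinear R X (add_zero n))
  map_id Y := by
    ext e
    simp
  map_comp g g' := by
    ext e
    simp only [ModuleCat.hom_ofHom, ModuleCat.hom_comp, LinearMap.comp_apply,
      LinearMap.flip_apply, Ext.bilinearCompOfLinear_apply_apply]
    rw [← Ext.mk₀_comp_mk₀]
    exact (Ext.comp_assoc _ _ _ (by lia) (by lia) (by lia)).symm

variable {C}

/-- For `n > 0` the functor `Extⁿ(X, -)` on the injectively stable category. -/
def extInjStable (n : ℕ) (hn : 0 < n) (X : C) : InjStable C ⥤ ModuleCat.{w} R :=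
  CategoryTheory.Quotient.lift (injRel C) (extObj C R n X) (by
    rintro Y Y' g g' ⟨J, hJ, a, b, h⟩
    ext (e : Ext X Y n)
    change e.comp (Ext.mk₀ g) (add_zero n) = e.comp (Ext.mk₀ g') (add_zero n)
    rw [← sub_eq_zero]
    obtain ⟨m, rfl⟩ : ∃ m, n = m + 1 := ⟨n - 1, by lia⟩
    have key : e.comp (Ext.mk₀ a) (add_zero _) = 0 := Ext.eq_zero_of_injective _
    have : e.comp (Ext.mk₀ g) (add_zero _) = e.comp (Ext.mk₀ (g' + a ≫ b)) (add_zero _) := by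
      rw [← h, add_sub_cancel]
    rw [this, Ext.mk₀_add, Ext.comp_add, add_sub_cancel_left, ← Ext.mk₀_comp_mk₀,
      ← Ext.comp_assoc e (Ext.mk₀ a) (Ext.mk₀ b) (add_zero _) (by lia) (by lia), key,
      Ext.zero_comp])

/-- The natural transformation `Extⁿ(X', -) ⟶ Extⁿ(X, -)` induced by `f : X ⟶ X'`. -/
def extInjStableMap (n : ℕ) (hn : 0 < n) {X X' : C} (f : X ⟶ X') :
    extInjStable R n hn X' ⟶ extInjStable R n hn X :=
  CategoryTheory.Quotient.natTransLift (injRel C)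
    { app := fun Y => ModuleCat.ofHom ((Ext.mk₀ f).precompOfLinear R Y (zero_add n))
      naturality := fun Y Y' g => by
        ext (e : Ext X' Y n)
        exact (Ext.comp_assoc _ _ _ (by lia) (by lia) (by lia)).symm }

theorem extInjStableMap_apply (n : ℕ) (hn : 0 < n) {X X' : C} (f : X ⟶ X') (Y : C)
    (e : Ext.{w} X' Y n) :
    ((extInjStableMap R n hn f).app ((CategoryTheory.Quotient.functor (injRel C)).obj Y)).hom e
      = (Ext.mk₀ f).comp e (zero_add n) := rfl

variable (C)

/-- For `n > 0` the bifunctor `Extⁿ(-, -)`, contravariant on the projectively stable category in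
the first and covariant on the injectively stable category in the second variable, with values
in `R`-modules. -/
def extStable (n : ℕ) (hn : 0 < n) : (ProjStable C)ᵒᵖ ⥤ InjStable C ⥤ ModuleCat.{w} R :=
  (CategoryTheory.Quotient.lift (projRel C)
    { obj := fun X => op (extInjStable R n hn X)
      map := fun f => (extInjStableMap R n hn f).op
      map_id := fun X => by
        refine Quiver.Hom.unop_inj ?_
        ext ⟨Y⟩ (e : Ext X Y n)
        change (Ext.mk₀ (𝟙 X)).comp e (zero_add n) = e
        simp
      map_comp := fun {X X' X''} f g => by
        refine Quiver.Hom.unop_inj ?_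
        ext ⟨Y⟩ (e : Ext X'' Y n)
        change (Ext.mk₀ (f ≫ g)).comp e (zero_add n)
          = (Ext.mk₀ f).comp ((Ext.mk₀ g).comp e (zero_add n)) (zero_add n)
        simp }
    (by
      rintro X X' f f' ⟨P, hP, a, b, h⟩
      refine Quiver.Hom.unop_inj ?_
      ext ⟨Y⟩ (e : Ext X' Y n)
      change (Ext.mk₀ f).comp e (zero_add n) = (Ext.mk₀ f').comp e (zero_add n)
      obtain ⟨m, rfl⟩ : ∃ m, n = m + 1 := ⟨n - 1, by lia⟩
      have key : (Ext.mk₀ b).comp e (zero_add _) = 0 := Ext.eq_zero_of_projective _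
      have : f = f' + a ≫ b := by rw [← h, add_sub_cancel]
      rw [this, Ext.mk₀_add, Ext.add_comp, ← Ext.mk₀_comp_mk₀_assoc, key, Ext.comp_zero,
        add_zero])).leftOp

end Ext

/-! ### Finitely generated modules over an Artin algebra -/

section FinMod

/-- The category of finitely generated left modules over an `R`-algebra `A`. The base ring `R` is
recorded so that the category carries its `R`-linear structure. Right modules over `Λ` are left
modules over `Λᵐᵒᵖ`, so the category of finitely generated right `Λ`-modules is
`FinMod R Λᵐᵒᵖ`. -/
def FinMod (_R A : Type u) [Ring A] : Type (u + 1) := FGModuleCat.{u} A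

variable {R A : Type u} [CommRing R] [Ring A] [Algebra R A]

instance : Category.{u} (FinMod R A) := inferInstanceAs (Category (FGModuleCat.{u} A))

/-- The underlying type of a finitely generated module. -/
def FinMod.carrier (X : FinMod R A) : Type u := ModuleCat.carrier (ObjectProperty.FullSubcategory.obj X)

instance : CoeSort (FinMod R A) (Type u) := ⟨FinMod.carrier⟩

instance (X : FinMod R A) : AddCommGroup X :=
  inferInstanceAs (AddCommGroup (ModuleCat.carrier (ObjectProperty.FullSubcategory.obj X)))

instance (X : FinMod R A) : Module A X :=
  inferInstanceAs (Module A (ModuleCat.carrier (ObjectProperty.FullSubcategory.obj X)))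

instance (X : FinMod R A) : Module.Finite A X := ObjectProperty.FullSubcategory.property X

instance (X : FinMod R A) : Module R X := Module.compHom X (algebraMap R A)

instance (X : FinMod R A) : IsScalarTower R A X :=
  ⟨fun r a x => by
    rw [Algebra.smul_def, mul_smul]
    rfl⟩

/-- A finitely generated module as an object of the category. -/
def FinMod.of (M : Type u) [AddCommGroup M] [Module A M] [Module.Finite A M] : FinMod R A :=
  FGModuleCat.of A M

/-- The linear map underlying a morphism. -/
def FinMod.hom {X Y : FinMod R A} (f : X ⟶ Y) : X →ₗ[A] Y :=
  ModuleCat.Hom.hom (InducedCategory.Hom.hom f)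

/-- A linear map as a morphism. -/
def FinMod.ofHom {X Y : FinMod R A} (f : X →ₗ[A] Y) : X ⟶ Y := ⟨ModuleCat.ofHom f⟩

theorem FinMod.ext_hom {X Y : FinMod R A} {f g : X ⟶ Y} (h : FinMod.hom f = FinMod.hom g) :
    f = g := FGModuleCat.hom_ext h

theorem FinMod.hom_ofHom {X Y : FinMod R A} (f : X →ₗ[A] Y) : FinMod.hom (FinMod.ofHom f) = f :=
  rfl

theorem FinMod.hom_comp {X Y Z : FinMod R A} (f : X ⟶ Y) (g : Y ⟶ Z) :
    FinMod.hom (f ≫ g) = (FinMod.hom g).comp (FinMod.hom f) := rfl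

theorem FinMod.hom_id (X : FinMod R A) : FinMod.hom (𝟙 X) = LinearMap.id := rfl

theorem isNoetherianRing_of_artin (R A : Type u) [CommRing R] [IsArtinianRing R] [Ring A]
    [Algebra R A] [Module.Finite R A] : IsNoetherianRing A :=
  isNoetherian_of_tower R (inferInstance : IsNoetherian R A)

variable [IsArtinianRing R] [Module.Finite R A]

instance : Abelian (FinMod R A) :=
  haveI := isNoetherianRing_of_artin R A
  inferInstanceAs (Abelian (FGModuleCat.{u} A))

theorem FinMod.hom_add {X Y : FinMod R A} (f g : X ⟶ Y) :
    FinMod.hom (f + g) = FinMod.hom f + FinMod.hom g := rfl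

/-- The scalar multiplication of `R` on morphisms, `(r f)(x) = r f(x)`. -/
instance FinMod.smulHom (X Y : FinMod R A) : SMul R (X ⟶ Y) where
  smul r f := FinMod.ofHom
    { toFun := fun x => r • FinMod.hom f x
      map_add' := fun x y => by rw [map_add, smul_add]
      map_smul' := fun a x => by rw [map_smul, smul_comm, RingHom.id_apply] }

instance : Linear R (FinMod R A) where
  homModule X Y :=
    { toSMul := FinMod.smulHom X Y
      one_smul := fun f => FinMod.ext_hom (LinearMap.ext fun x => one_smul R (FinMod.hom f x))
      mul_smul := fun r s f =>
        FinMod.ext_hom (LinearMap.ext fun x => mul_smul r s (FinMod.hom f x))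
      smul_zero := fun r => FinMod.ext_hom (LinearMap.ext fun _ => (smul_zero r : r • (0 : Y) = 0))
      smul_add := fun r f g =>
        FinMod.ext_hom (LinearMap.ext fun x => smul_add r (FinMod.hom f x) (FinMod.hom g x))
      add_smul := fun r s f =>
        FinMod.ext_hom (LinearMap.ext fun x => add_smul r s (FinMod.hom f x))
      zero_smul := fun f => FinMod.ext_hom (LinearMap.ext fun x => zero_smul R (FinMod.hom f x)) }
  smul_comp := fun X Y Z r f g => FinMod.ext_hom (LinearMap.ext fun x => by
    change FinMod.hom g (r • FinMod.hom f x) = r • FinMod.hom g (FinMod.hom f x)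
    rw [algebra_compatible_smul A r, map_smul, ← algebra_compatible_smul A r])
  comp_smul X Y Z f r g := rfl

theorem FinMod.hom_smul {X Y : FinMod R A} (r : R) (f : X ⟶ Y) (x : X) :
    FinMod.hom (r • f) x = r • FinMod.hom f x := rfl

instance (X : FinMod R A) : Module.Finite R X := Module.Finite.trans A X

theorem FinMod.surjective_of_epi {X Y : FinMod R A} (f : X ⟶ Y) [hf : Epi f] :
    Function.Surjective (FinMod.hom f) := by
  have := isNoetherianRing_of_artin R A
  have h : Epi ((forget₂ (FGModuleCat.{u} A) (ModuleCat.{u} A)).map f) :=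
    @CategoryTheory.Functor.map_epi _ _ _ _ (forget₂ (FGModuleCat.{u} A) (ModuleCat.{u} A))
      inferInstance X Y f hf
  exact (ModuleCat.epi_iff_surjective _).1 h

theorem FinMod.injective_of_mono {X Y : FinMod R A} (f : X ⟶ Y) [hf : Mono f] :
    Function.Injective (FinMod.hom f) := by
  have := isNoetherianRing_of_artin R A
  have h : Mono ((forget₂ (FGModuleCat.{u} A) (ModuleCat.{u} A)).map f) :=
    @CategoryTheory.Functor.map_mono _ _ _ _ (forget₂ (FGModuleCat.{u} A) (ModuleCat.{u} A))
      inferInstance Y X f hf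
  exact (ModuleCat.mono_iff_injective _).1 h

theorem FinMod.epi_of_surjective {X Y : FinMod R A} (f : X ⟶ Y)
    (hf : Function.Surjective (FinMod.hom f)) : Epi f where
  left_cancellation g h e := FinMod.ext_hom (LinearMap.ext fun y => by
    obtain ⟨x, rfl⟩ := hf y
    exact LinearMap.congr_fun (congrArg FinMod.hom e) x)

theorem FinMod.projective_of_module {X : FinMod R A} (h : Module.Projective A X) :
    Projective X where
  factors {E Y} f e he := by
    obtain ⟨k, hk⟩ := Module.projective_lifting_property (FinMod.hom e) (FinMod.hom f)
      (FinMod.surjective_of_epi e)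
    exact ⟨FinMod.ofHom k, FinMod.ext_hom hk⟩

/-- The free module of rank `n`. -/
def FinMod.free (R A : Type u) [Ring A] (n : ℕ) : FinMod R A := FinMod.of (Fin n → A)

instance (n : ℕ) : Projective (FinMod.free R A n) :=
  FinMod.projective_of_module (inferInstanceAs (Module.Projective A (Fin n → A)))

theorem FinMod.exists_epi_free (X : FinMod R A) : ∃ (n : ℕ) (f : FinMod.free R A n ⟶ X), Epi f := by
  obtain ⟨n, f, hf⟩ := Module.Finite.exists_fin' A X
  exact ⟨n, FinMod.ofHom (X := FinMod.free R A n) f, FinMod.epi_of_surjective _ hf⟩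

instance : EnoughProjectives (FinMod R A) where
  presentation X := by
    obtain ⟨n, f, hf⟩ := FinMod.exists_epi_free X
    exact ⟨{ p := FinMod.free R A n, f := f }⟩

instance : HasExt.{u} (FinMod R A) := hasExt_of_enoughProjectives _

/-- A projective object is a retract of a free module of finite rank. -/
theorem FinMod.exists_retract (P : FinMod R A) [Projective P] :
    ∃ (n : ℕ) (i : P ⟶ FinMod.free R A n) (p : FinMod.free R A n ⟶ P), i ≫ p = 𝟙 P := by
  obtain ⟨n, f, hf⟩ := FinMod.exists_epi_free P
  exact ⟨n, Projective.factorThru (𝟙 P) f, f, Projective.factorThru_comp _ _⟩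

end FinMod

section RingDual

variable (R Λ : Type u) [CommRing R] [IsArtinianRing R] [Ring Λ] [Algebra R Λ] [Module.Finite R Λ]

instance (X : FinMod R Λᵐᵒᵖ) : Module.Finite Λ (X →ₗ[Λᵐᵒᵖ] Λ) := by
  have : IsScalarTower R Λᵐᵒᵖ Λ := ⟨fun r a x => by
    induction a using MulOpposite.rec' with
    | _ a => 
    rw [← MulOpposite.op_smul]
    simp⟩
  have : IsNoetherian R (X →ₗ[Λᵐᵒᵖ] Λ) :=
    isNoetherian_of_injective (LinearMap.restrictScalarsₗ R Λᵐᵒᵖ X Λ R)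
      (LinearMap.restrictScalars_injective R)
  exact Module.Finite.of_restrictScalars_finite R Λ _

/-- The contravariant functor `Hom(-, Λ)` from finitely generated right to finitely generated left
`Λ`-modules, where `Λ` acts on homomorphisms by left multiplication on the values. -/
def ringDual : (FinMod R Λᵐᵒᵖ)ᵒᵖ ⥤ FinMod R Λ where
  obj X := FinMod.of (X.unop →ₗ[Λᵐᵒᵖ] Λ)
  map {X Y} f := FinMod.ofHom (X := FinMod.of (X.unop →ₗ[Λᵐᵒᵖ] Λ))
    (Y := FinMod.of (Y.unop →ₗ[Λᵐᵒᵖ] Λ)) (LinearMap.lcomp Λ Λ (FinMod.hom f.unop))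
  map_id _ := rfl
  map_comp _ _ := rfl

instance : (ringDual R Λ).Additive where
  map_add {X Y f g} := FinMod.ext_hom (LinearMap.ext fun (φ : X.unop →ₗ[Λᵐᵒᵖ] Λ) =>
    LinearMap.ext fun y => map_add φ (FinMod.hom f.unop y) (FinMod.hom g.unop y))

theorem ringDual_projective (P : FinMod R Λᵐᵒᵖ) (hP : Projective P) :
    Projective ((ringDual R Λ).obj (op P)) := by
  obtain ⟨n, i, p, h⟩ := FinMod.exists_retract P
  have e : (Fin n → Λ) ≃ₗ[Λ] ((Fin n → Λᵐᵒᵖ) →ₗ[Λᵐᵒᵖ] Λ) := (Pi.basisFun Λᵐᵒᵖ (Fin n)).constr Λ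
  have hfree : Projective ((ringDual R Λ).obj (op (FinMod.free R Λᵐᵒᵖ n))) :=
    FinMod.projective_of_module (Module.Projective.of_equiv e)
  exact Retract.projective ⟨(ringDual R Λ).map p.op, (ringDual R Λ).map i.op, by
    rw [← CategoryTheory.Functor.map_comp, ← op_comp, h, op_id, CategoryTheory.Functor.map_id]⟩

end RingDual

section Dual

/-- `ι` exhibits `I` as an injective envelope of `S`: `I` is an injective module and `ι` is an
essential monomorphism. -/
structure IsInjectiveEnvelope {R : Type u} [CommRing R] {S I : Type u} [AddCommGroup S] [Module R S]
    [AddCommGroup I] [Module R I] (ι : S →ₗ[R] I) : Prop where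
  injective_module : Module.Injective R I
  injective : Function.Injective ι
  essential : ∀ U : Submodule R I, U ⊓ LinearMap.range ι = ⊥ → U = ⊥

/-- `I` is an injective envelope of `S₁ ⊕ ⋯ ⊕ Sₙ`, where `S₁, …, Sₙ` is a complete set of
representatives of the isomorphism classes of the simple `R`-modules. -/
def IsEnvelopeOfSimples (R : Type u) [CommRing R] (I : Type u) [AddCommGroup I] [Module R I] :
    Prop :=
  ∃ (n : ℕ) (S : Fin n → ModuleCat.{u} R),
    (∀ i, IsSimpleModule R (S i)) ∧
    (∀ i j, Nonempty (S i ≃ₗ[R] S j) → i = j) ∧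
    (∀ (T : Type u) [AddCommGroup T] [Module R T], IsSimpleModule R T →
      ∃ i, Nonempty (T ≃ₗ[R] S i)) ∧
    ∃ ι : (∀ i, S i) →ₗ[R] I, IsInjectiveEnvelope ι

variable {R : Type u} [CommRing R] [IsArtinianRing R] {I : Type u} [AddCommGroup I] [Module R I]

theorem isNoetherian_dual_of_simple (hI : IsEnvelopeOfSimples R I) (T : Type u) [AddCommGroup T]
    [Module R T] [IsSimpleModule R T] : IsNoetherian R (T →ₗ[R] I) := by
  obtain ⟨n, S, hS, -, -, ι, hι⟩ := hI
  refine isNoetherian_of_surjective (LinearMap.compRight R ι (M := T)) ?_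
  rw [LinearMap.range_eq_top]
  intro φ
  have hφ : ∀ t, φ t ∈ LinearMap.range ι := by
    rcases eq_bot_or_eq_top ((LinearMap.range ι).comap φ) with h | h
    · have h0 : LinearMap.range φ = ⊥ := by
        apply hι.essential
        rw [eq_bot_iff]
        rintro _ ⟨⟨t, rfl⟩, ht⟩
        have : t ∈ (LinearMap.range ι).comap φ := ht
        rw [h] at this
        rw [(Submodule.mem_bot R).1 this, map_zero]
        exact Submodule.zero_mem _
      intro t
      have : φ t ∈ LinearMap.range φ := ⟨t, rfl⟩
      rw [h0] at this
      rw [(Submodule.mem_bot R).1 this]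
      exact Submodule.zero_mem _
    · intro t
      have : t ∈ (LinearMap.range ι).comap φ := by rw [h]; trivial
      exact this
  refine ⟨(LinearEquiv.ofInjective ι hι.injective).symm.toLinearMap ∘ₗ
    φ.codRestrict (LinearMap.range ι) hφ, ?_⟩
  ext t
  exact congrArg Subtype.val ((LinearEquiv.ofInjective ι hι.injective).apply_symm_apply
    (φ.codRestrict (LinearMap.range ι) hφ t))

theorem isNoetherian_dual (hI : IsEnvelopeOfSimples R I) (M : Type u) [AddCommGroup M]
    [Module R M] [Module.Finite R M] : IsNoetherian R (M →ₗ[R] I) := by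
  have hM : IsFiniteLength R M :=
    isFiniteLength_iff_isNoetherian_isArtinian.2 ⟨inferInstance, inferInstance⟩
  induction hM with
  | of_subsingleton => 
    infer_instance
  | @of_simple_quotient M _ _ N _ _ ih =>
    have := isNoetherian_dual_of_simple hI (M ⧸ N)
    refine isNoetherian_of_range_eq_ker (LinearMap.lcomp R I N.mkQ) (LinearMap.lcomp R I N.subtype)
      ?_
    ext φ
    constructor
    · rintro ⟨ψ, rfl⟩
      ext x
      change ψ (Submodule.Quotient.mk x) = 0
      rw [(Submodule.Quotient.mk_eq_zero N).2 x.2, map_zero]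
    · intro h
      exact ⟨N.liftQ φ (fun x hx => LinearMap.congr_fun h ⟨x, hx⟩), by ext; rfl⟩

variable {Λ : Type u} [Ring Λ] [Algebra R Λ]

/-- The right `Λ`-module structure on `Hom_R(X, I)` for a left `Λ`-module `X`:
`(φ a)(x) = φ (a x)`. -/
instance dualModule (X : FinMod R Λ) : Module Λᵐᵒᵖ (X →ₗ[R] I) where
  smul a φ := φ ∘ₗ Algebra.lsmul R R X a.unop
  one_smul φ := LinearMap.ext fun x => congrArg φ (one_smul Λ x)
  mul_smul a b φ := LinearMap.ext fun x => congrArg φ (mul_smul b.unop a.unop x)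
  smul_zero _ := rfl
  smul_add _ _ _ := rfl
  add_smul a b φ := LinearMap.ext fun x => by
    change φ ((a.unop + b.unop) • x) = φ (a.unop • x) + φ (b.unop • x)
    rw [add_smul, map_add]
  zero_smul φ := LinearMap.ext fun x => by
    change φ ((0 : Λ) • x) = 0
    rw [zero_smul, map_zero]

theorem dual_smul_apply (X : FinMod R Λ) (a : Λᵐᵒᵖ) (φ : X →ₗ[R] I) (x : X) :
    (a • φ) x = φ (a.unop • x) := rfl

variable [Module.Finite R Λ]

theorem dual_finite (hI : IsEnvelopeOfSimples R I) (X : FinMod R Λ) :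
    Module.Finite Λᵐᵒᵖ (X →ₗ[R] I) := by
  have := isNoetherian_dual hI X
  have : IsScalarTower R Λᵐᵒᵖ (X →ₗ[R] I) := ⟨fun r a φ => LinearMap.ext fun x => by
    change φ ((r • a.unop) • x) = r • φ (a.unop • x)
    rw [smul_assoc, map_smul]⟩
  exact Module.Finite.of_restrictScalars_finite R Λᵐᵒᵖ _

variable (I) in
/-- A homomorphism of `Λ`-modules, viewed as an `R`-linear map, induces by precomposition a
homomorphism of right `Λ`-modules between the duals. -/
def dualMap {X Y : FinMod R Λ} (f : X ⟶ Y) : (Y →ₗ[R] I) →ₗ[Λᵐᵒᵖ] (X →ₗ[R] I) where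
  toFun φ := φ ∘ₗ (FinMod.hom f).restrictScalars R
  map_add' _ _ := rfl
  map_smul' a φ := LinearMap.ext fun x => congrArg φ (map_smul (FinMod.hom f) a.unop x).symm

variable (Λ) in
/-- The duality `D = Hom_R(-, I)` from finitely generated left to finitely generated right
`Λ`-modules. -/
def dualFunctor (hI : IsEnvelopeOfSimples R I) : (FinMod R Λ)ᵒᵖ ⥤ FinMod R Λᵐᵒᵖ where
  obj X := haveI := dual_finite hI X.unop; FinMod.of (X.unop →ₗ[R] I)
  map {X Y} f :=
    haveI := dual_finite hI X.unop
    haveI := dual_finite hI Y.unop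
    FinMod.ofHom (X := FinMod.of (X.unop →ₗ[R] I)) (Y := FinMod.of (Y.unop →ₗ[R] I))
      (dualMap I f.unop)
  map_id _ := rfl
  map_comp _ _ := rfl

instance (hI : IsEnvelopeOfSimples R I) : (dualFunctor Λ hI).Additive where
  map_add {X Y f g} := FinMod.ext_hom (LinearMap.ext fun (φ : X.unop →ₗ[R] I) =>
    LinearMap.ext fun y => map_add φ (FinMod.hom f.unop y) (FinMod.hom g.unop y))

theorem dual_free_injective (hI : IsEnvelopeOfSimples R I) (n : ℕ) :
    Injective ((dualFunctor Λ hI).obj (op (FinMod.free R Λ n))) where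
  factors {X Y} g m hm := by
    have hinj : Module.Injective R I := by
      obtain ⟨_, _, -, -, -, _, h⟩ := hI
      exact h.injective_module
    let g' : X →ₗ[Λᵐᵒᵖ] (FinMod.free R Λ n →ₗ[R] I) := FinMod.hom g
    have hg' : ∀ (a : Λᵐᵒᵖ) (x : X) (v : FinMod.free R Λ n), g' (a • x) v = g' x (a.unop • v) :=
      fun a x v => LinearMap.congr_fun (map_smul g' a x) v
    let E (i : Fin n) : FinMod.free R Λ n := (Pi.single i 1 : Fin n → Λ)
    let γ (i : Fin n) : X →ₗ[R] I :=
      { toFun := fun x => g' x (E i)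
        map_add' := fun x y => by rw [map_add]; rfl
        map_smul' := fun r x => (hg' (algebraMap R Λᵐᵒᵖ r) x (E i)).trans (map_smul (g' x) r (E i)) }
    have hex : ∀ i, ∃ h : Y →ₗ[R] I, ∀ x, h (FinMod.hom m x) = γ i x := fun i =>
      hinj.out ((FinMod.hom m).restrictScalars R) (FinMod.injective_of_mono m) (γ i)
    choose h hh using hex
    let G : Y →ₗ[Λᵐᵒᵖ] (FinMod.free R Λ n →ₗ[R] I) :=
      { toFun := fun y =>
          { toFun := fun v => ∑ i, h i (MulOpposite.op ((v : Fin n → Λ) i) • y)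
            map_add' := fun v w => by
              rw [← Finset.sum_add_distrib]
              refine Finset.sum_congr rfl fun i _ => ?_
              rw [← map_add, ← add_smul]
              rfl
            map_smul' := fun r v => by
              rw [RingHom.id_apply, Finset.smul_sum]
              refine Finset.sum_congr rfl fun i _ => ?_
              rw [← map_smul, ← smul_assoc, ← MulOpposite.op_smul]
              congr 3
              exact (Algebra.smul_def r _).symm }
        map_add' := fun y z => LinearMap.ext fun v => by
          change ∑ i, h i _ = ∑ i, h i _ + ∑ i, h i _
          rw [← Finset.sum_add_distrib]
          refine Finset.sum_congr rfl fun i _ => ?_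
          rw [← map_add, ← smul_add]
        map_smul' := fun a y => LinearMap.ext fun v => by
          change ∑ i, h i _ = ∑ i, h i _
          refine Finset.sum_congr rfl fun i _ => ?_
          rw [← mul_smul]
          rfl }
    refine ⟨FinMod.ofHom G, FinMod.ext_hom (LinearMap.ext fun x => LinearMap.ext fun v => ?_)⟩
    change ∑ i, h i (MulOpposite.op ((v : Fin n → Λ) i) • FinMod.hom m x) = g' x v
    have h1 : ∀ i, h i (MulOpposite.op ((v : Fin n → Λ) i) • FinMod.hom m x)
        = g' x ((v : Fin n → Λ) i • E i) := fun i => by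
      rw [← map_smul, hh]
      exact hg' _ _ _
    rw [Finset.sum_congr rfl fun i _ => h1 i, ← map_sum]
    congr 1
    exact (pi_eq_sum_univ' (v : Fin n → Λ)).symm.trans rfl

theorem dual_injective (hI : IsEnvelopeOfSimples R I) (P : FinMod R Λ) (hP : Projective P) :
    Injective ((dualFunctor Λ hI).obj (op P)) := by
  obtain ⟨n, i, p, h⟩ := FinMod.exists_retract P
  have := dual_free_injective (Λ := Λ) hI n
  exact Retract.injective ⟨(dualFunctor Λ hI).map p.op, (dualFunctor Λ hI).map i.op, by
    rw [← CategoryTheory.Functor.map_comp, ← op_comp, h, op_id, CategoryTheory.Functor.map_id]⟩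

end Dual

/-! ### Cluster-tilting subcategories and the two bifunctors -/

section ClusterTilting

variable {C : Type u} [Category.{v} C] [Abelian C] [HasExt.{w} C]

/-- The full subcategory of `C` on the objects with property `M` is a `d`-cluster-tilting
subcategory: it is closed under direct sums and summands, functorially finite, and equal to both
Ext-orthogonal subcategories of `M` in degrees `1, …, d - 1`. -/
structure IsClusterTilting (d : ℕ) (M : ObjectProperty C) : Prop where
  /-- `M` is closed under direct sums. -/
  biprod_mem : ∀ X Y : C, M X → M Y → M (X ⊞ Y)
  /-- `M` is closed under direct summands (in particular under isomorphisms). -/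
  summand_mem : ∀ (X Y : C) (i : X ⟶ Y) (p : Y ⟶ X), i ≫ p = 𝟙 X → M Y → M X
  /-- Every object has a right `M`-approximation. -/
  contravariantly_finite : ∀ X : C, ∃ (N : C) (f : N ⟶ X), M N ∧
    ∀ (N' : C), M N' → ∀ g : N' ⟶ X, ∃ h : N' ⟶ N, h ≫ f = g
  /-- Every object has a left `M`-approximation. -/
  covariantly_finite : ∀ X : C, ∃ (N : C) (f : X ⟶ N), M N ∧
    ∀ (N' : C), M N' → ∀ g : X ⟶ N', ∃ h : N ⟶ N', f ≫ h = g
  /-- `M` consists of the `X` with `Ext^k(X, M) = 0` for `0 < k < d`. -/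
  mem_iff_left : ∀ X : C, M X ↔
    ∀ k : ℕ, 1 ≤ k → k < d → ∀ N : C, M N → Subsingleton (Ext.{w} X N k)
  /-- `M` consists of the `Y` with `Ext^k(M, Y) = 0` for `0 < k < d`. -/
  mem_iff_right : ∀ Y : C, M Y ↔
    ∀ k : ℕ, 1 ≤ k → k < d → ∀ N : C, M N → Subsingleton (Ext.{w} N Y k)

end ClusterTilting

section Main

variable {R : Type u} [CommRing R] [IsArtinianRing R] {I : Type u} [AddCommGroup I] [Module R I]
  (Λ : Type u) [Ring Λ] [Algebra R Λ] [Module.Finite R Λ]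

/-- The functor `Tr_d = Tr Ω^{d-1}` from the stable category of right to that of left
`Λ`-modules (used for `d ≥ 1` only). -/
def higherTranspose (R : Type u) [CommRing R] [IsArtinianRing R] (Λ : Type u) [Ring Λ]
    [Algebra R Λ] [Module.Finite R Λ] (d : ℕ) :
    ProjStable (FinMod R Λᵐᵒᵖ) ⥤ (ProjStable (FinMod R Λ))ᵒᵖ :=
  iteratedSyzygy (FinMod R Λᵐᵒᵖ) (d - 1) ⋙
    transposeFunctor (ringDual R Λ) (ringDual_projective R Λ)

/-- The higher Auslander–Reiten translation `τ_d = D Tr_d`, from the projectively stable to the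
injectively stable category of finitely generated right `Λ`-modules. -/
def higherTau (hI : IsEnvelopeOfSimples R I) (d : ℕ) :
    ProjStable (FinMod R Λᵐᵒᵖ) ⥤ InjStable (FinMod R Λᵐᵒᵖ) :=
  higherTranspose R Λ d ⋙ dualityStable (dualFunctor Λ hI) (dual_injective hI)

variable {Λ}

/-- The full subcategory of the projectively stable category of right `Λ`-modules on the objects
of `M`. -/
abbrev StableSub (M : ObjectProperty (FinMod R Λᵐᵒᵖ)) : Type (u + 1) :=
  ObjectProperty.FullSubcategory
    (fun X : ProjStable (FinMod R Λᵐᵒᵖ) => M X.as)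

/-- The inclusion of the stable category of `M` into the stable category of right `Λ`-modules. -/
def StableSub.incl (M : ObjectProperty (FinMod R Λᵐᵒᵖ)) :
    StableSub M ⥤ ProjStable (FinMod R Λᵐᵒᵖ) :=
  ObjectProperty.ι _

variable (R I) in
/-- The functor `D = Hom_R(-, I)` on `R`-modules. -/
def baseDual : (ModuleCat.{u} R)ᵒᵖ ⥤ ModuleCat.{u} R where
  obj V := ModuleCat.of R (V.unop →ₗ[R] I)
  map f := ModuleCat.ofHom (LinearMap.lcomp R I f.unop.hom)

variable (I) in
/-- The bifunctor `(X, Y) ↦ D (stable Hom(X, Y))`, covariant in `X` and contravariant in `Y`. -/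
def dualStableHom (M : ObjectProperty (FinMod R Λᵐᵒᵖ)) :
    StableSub M ⥤ (StableSub M)ᵒᵖ ⥤ ModuleCat.{u} R :=
  (linearCoyoneda R (StableSub M)).rightOp ⋙ Functor.opHom _ _ ⋙
    (Functor.whiskeringRight _ _ _).obj (baseDual R I)

/-- The bifunctor `(X, Y) ↦ Ext^d(Y, τ_d X)`, covariant in `X` and contravariant in `Y`. -/
def extTau (hI : IsEnvelopeOfSimples R I) (d : ℕ) (hd : 0 < d)
    (M : ObjectProperty (FinMod R Λᵐᵒᵖ)) :
    StableSub M ⥤ (StableSub M)ᵒᵖ ⥤ ModuleCat.{u} R :=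
  StableSub.incl M ⋙ higherTau Λ hI d ⋙ (extStable (FinMod R Λᵐᵒᵖ) R d hd).flip ⋙
    (Functor.whiskeringLeft _ _ _).obj (StableSub.incl M).op

theorem dualStableHom_obj_obj (M : ObjectProperty (FinMod R Λᵐᵒᵖ)) (X Y : StableSub M) :
    ((dualStableHom I M).obj X).obj (op Y) = ModuleCat.of R ((X ⟶ Y) →ₗ[R] I) := rfl

theorem extTau_obj_obj (hI : IsEnvelopeOfSimples R I) (d : ℕ) (hd : 0 < d)
    (M : ObjectProperty (FinMod R Λᵐᵒᵖ)) (X Y : StableSub M) :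
    ((extTau hI d hd M).obj X).obj (op Y)
      = ModuleCat.of R (Ext.{u} Y.obj.as ((higherTau Λ hI d).obj X.obj).as d) := rfl

end Main

end HigherAR

end

noncomputable section

namespace HigherAR

/-! ### Exactness of sequences of finitely generated modules -/

section Exactness

variable {R A : Type u} [CommRing R] [IsArtinianRing R] [Ring A] [Algebra R A] [Module.Finite R A]

/-! Write `ν P = D Hom(P, Λ)` for projective `P`. Evaluation at elements and forms gives `D Hom(P,
Y) ≅ Hom(Y, ν P)`, naturally in both variables (`nakayamaHom_bijective`), and `ν P` is injective.

Case `d = 1`. A projective presentation `P₁ ⟶ P₀ ⟶ X ⟶ 0` yields an exact sequence `0 ⟶ τ X ⟶ ν P₁ ⟶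
ν P₀`. Let `K` be the image of the last map. As `ν P₁` is injective, `Ext¹(Y, τ X)` is `Hom(Y, K)`
modulo the morphisms that lift to `ν P₁`. A morphism `Y ⟶ K ⊆ ν P₀` is a functional on `Hom(P₀, Y)`;
restricted along `P₀ ⟶ X` it becomes a functional on `Hom(X, Y)`. Landing in `K` is what makes it
vanish on morphisms through projectives. Every functional on stable morphisms arises in this way,
and the zero functional comes exactly from the morphisms that lift to `ν P₁`
(`stableFunctional_surjective`, `stableFunctional_eq_zero_iff`). So `Hom(Y, K)` surjects onto both
sides with the same kernel, which is `arEquiv`.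

Higher `d`. If `Ext¹(Z, Λ) = 0`, there is a short exact sequence `0 ⟶ τ Ω Z ⟶ ν P₂ ⟶ τ Z ⟶ 0` with
injective middle term (`tau_shortExact`). Its extension class shifts `Extⁿ⁺¹(Y, τ Z)` isomorphically
onto `Extⁿ⁺²(Y, τ Ω Z)`. Cluster tilting supplies the vanishing: `Λ` is projective, hence lies in
`M`, so `Extᵏ(X, Λ) = 0` for `0 < k < d`, and therefore `Ext¹(Ωⁱ X, Λ) = 0` for `i < d - 1`.
Composing `d - 1` shifts with the case `d = 1` gives the isomorphism. Naturality in `X` holds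
because lifting a morphism to projective resolutions gives morphisms between all these short exact
sequences. -/

theorem FinMod.mono_of_injective {X Y : FinMod R A} (f : X ⟶ Y)
    (hf : Function.Injective (FinMod.hom f)) : Mono f where
  right_cancellation g h e := FinMod.ext_hom (LinearMap.ext fun x =>
    hf (LinearMap.congr_fun (congrArg FinMod.hom e) x))

theorem FinMod.hom_comp_apply {X Y Z : FinMod R A} (f : X ⟶ Y) (g : Y ⟶ Z) (x : X) :
    FinMod.hom (f ≫ g) x = FinMod.hom g (FinMod.hom f x) := rfl

/-- The forgetful functor to all modules is exact and faithful, so it preserves and reflects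
exactness. -/
theorem FinMod.exact_iff (S : ShortComplex (FinMod R A)) :
    S.Exact ↔ ∀ y : S.X₂, FinMod.hom S.g y = 0 → ∃ x : S.X₁, FinMod.hom S.f x = y := by
  have := isNoetherianRing_of_artin R A
  let F : FinMod R A ⥤ ModuleCat.{u} A := forget₂ (FGModuleCat.{u} A) (ModuleCat.{u} A)
  have : F.Additive := { map_add := rfl }
  have : F.Faithful :=
    inferInstanceAs (forget₂ (FGModuleCat.{u} A) (ModuleCat.{u} A)).Faithful
  have : PreservesFiniteLimits F :=
    inferInstanceAs (PreservesFiniteLimits (forget₂ (FGModuleCat.{u} A) (ModuleCat.{u} A)))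
  have : PreservesFiniteColimits F :=
    inferInstanceAs (PreservesFiniteColimits (forget₂ (FGModuleCat.{u} A) (ModuleCat.{u} A)))
  have h := ShortComplex.exact_map_iff_of_faithful S F
  rw [ShortComplex.moduleCat_exact_iff] at h
  exact h.symm

theorem FinMod.shortExact_of (S : ShortComplex (FinMod R A))
    (hf : Function.Injective (FinMod.hom S.f))
    (h : ∀ y : S.X₂, FinMod.hom S.g y = 0 → ∃ x : S.X₁, FinMod.hom S.f x = y)
    (hg : Function.Surjective (FinMod.hom S.g)) : S.ShortExact where
  exact := (FinMod.exact_iff S).2 h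
  mono_f := FinMod.mono_of_injective _ hf
  epi_g := FinMod.epi_of_surjective _ hg

/-- A morphism whose values lie in the range of a monomorphism factors through it. -/
theorem FinMod.exists_fac_of_mono {X Y Z : FinMod R A} (f : X ⟶ Z) (m : Y ⟶ Z) [Mono m]
    (h : ∀ x, ∃ y, FinMod.hom m y = FinMod.hom f x) : ∃ g : X ⟶ Y, g ≫ m = f := by
  have hm := FinMod.injective_of_mono m
  choose g hg using h
  exact ⟨FinMod.ofHom
    { toFun := g
      map_add' := fun x y => hm (by rw [hg, map_add, map_add, hg, hg])
      map_smul' := fun a x => hm (by rw [hg, map_smul, map_smul, hg, RingHom.id_apply]) },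
    FinMod.ext_hom (LinearMap.ext hg)⟩

theorem FinMod.hom_sum {X Y : FinMod R A} {ι : Type*} (s : Finset ι) (f : ι → (X ⟶ Y)) (x : X) :
    FinMod.hom (∑ i ∈ s, f i) x = ∑ i ∈ s, FinMod.hom (f i) x := by
  classical
  induction s using Finset.induction_on with
  | empty => simp only [Finset.sum_empty]; rfl
  | insert a s ha ih => rw [Finset.sum_insert ha, Finset.sum_insert ha, ← ih]; rfl

end Exactness

/-- Functionals with values in an injective module extend along linear maps on whose kernel they
vanish. -/
theorem exists_extension {R I : Type u} [CommRing R] [AddCommGroup I] [Module R I]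
    [Module.Injective R I] {B C : Type u} [AddCommGroup B] [Module R B] [AddCommGroup C] [Module R C]
    (g : B →ₗ[R] C) (φ : B →ₗ[R] I) (h : ∀ b, g b = 0 → φ b = 0) :
    ∃ χ : C →ₗ[R] I, ∀ b, χ (g b) = φ b := by
  -- The functional descends to `B / ker g`, which embeds into `C`.
  obtain ⟨χ, hχ⟩ := Module.Injective.out (Submodule.liftQ (LinearMap.ker g) g le_rfl)
    (LinearMap.ker_eq_bot.1 (Submodule.ker_liftQ_eq_bot' _ _ rfl))
    (Submodule.liftQ (LinearMap.ker g) φ h)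
  exact ⟨χ, fun b => hχ (Submodule.Quotient.mk b)⟩

theorem IsEnvelopeOfSimples.injective {R : Type u} [CommRing R] {I : Type u} [AddCommGroup I]
    [Module R I] (hI : IsEnvelopeOfSimples R I) : Module.Injective R I := by
  obtain ⟨_, _, -, -, -, _, h⟩ := hI
  exact h.injective_module

/-! ### The duals of morphism modules out of projectives -/

section Nakayama

variable {R : Type u} [CommRing R] [IsArtinianRing R] {I : Type u} [AddCommGroup I] [Module R I]
  {Λ : Type u} [Ring Λ] [Algebra R Λ] [Module.Finite R Λ]

/-- The morphism `p ↦ y ξ(p)` given by an element `y` and a form `ξ`. -/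
def evHom {P Y : FinMod R Λᵐᵒᵖ} (y : Y) (ξ : P →ₗ[Λᵐᵒᵖ] Λ) : P ⟶ Y :=
  FinMod.ofHom
    { toFun := fun p => MulOpposite.op (ξ p) • y
      map_add' := fun p q => by rw [map_add, MulOpposite.op_add, add_smul]
      map_smul' := fun a p => by
        rw [map_smul, RingHom.id_apply, ← mul_smul]
        rfl }

theorem hom_evHom {P Y : FinMod R Λᵐᵒᵖ} (y : Y) (ξ : P →ₗ[Λᵐᵒᵖ] Λ) (p : P) :
    FinMod.hom (evHom y ξ) p = MulOpposite.op (ξ p) • y := rfl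

theorem comp_evHom {P P' Y : FinMod R Λᵐᵒᵖ} (h : P ⟶ P') (y : Y) (ξ : P' →ₗ[Λᵐᵒᵖ] Λ) :
    h ≫ evHom y ξ = evHom y (ξ ∘ₗ FinMod.hom h) := rfl

theorem evHom_comp {P Y Y' : FinMod R Λᵐᵒᵖ} (g : Y ⟶ Y') (y : Y) (ξ : P →ₗ[Λᵐᵒᵖ] Λ) :
    evHom y ξ ≫ g = evHom (FinMod.hom g y) ξ :=
  FinMod.ext_hom (LinearMap.ext fun _ => map_smul (FinMod.hom g) _ _)

/-- Dual bases: the identity of a projective is a finite sum of morphisms `p ↦ pᵢ ξᵢ(p)`. -/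
theorem exists_dual_basis (P : FinMod R Λᵐᵒᵖ) [Projective P] :
    ∃ (n : ℕ) (q : Fin n → P) (ξ : Fin n → (P →ₗ[Λᵐᵒᵖ] Λ)), ∑ i, evHom (q i) (ξ i) = 𝟙 P := by
  obtain ⟨n, i, p, h⟩ := FinMod.exists_retract P
  let j : P →ₗ[Λᵐᵒᵖ] (Fin n → Λᵐᵒᵖ) := FinMod.hom i
  let r : (Fin n → Λᵐᵒᵖ) →ₗ[Λᵐᵒᵖ] P := FinMod.hom p
  refine ⟨n, fun k => r (Pi.single k 1), fun k =>
    { toFun := fun x => (j x k).unop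
      map_add' := fun x y => by rw [map_add]; rfl
      map_smul' := fun a x => by rw [map_smul]; rfl }, ?_⟩
  refine FinMod.ext_hom (LinearMap.ext fun x => ?_)
  rw [FinMod.hom_sum]
  have hx : r (j x) = x := LinearMap.congr_fun (congrArg FinMod.hom h) x
  refine Eq.trans ?_ hx
  conv_rhs => rw [pi_eq_sum_univ' (j x), map_sum]
  refine Finset.sum_congr rfl fun k _ => ?_
  rw [map_smul]
  rfl

/-- Inserting a dual basis of `Q` between the two factors: whatever factors through a projective is
a finite sum of morphisms `evHom`, so functionals need only be tested on those. -/
theorem eq_sum_evHom {P Q Y : FinMod R Λᵐᵒᵖ} {n : ℕ} {q : Fin n → Q}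
    {ξ : Fin n → (Q →ₗ[Λᵐᵒᵖ] Λ)} (h : ∑ i, evHom (q i) (ξ i) = 𝟙 Q) (a : P ⟶ Q) (b : Q ⟶ Y) :
    a ≫ b = ∑ i, a ≫ evHom (FinMod.hom b (q i)) (ξ i) := by
  conv_lhs => rw [← Category.comp_id a, ← h, Category.assoc, Preadditive.sum_comp,
    Preadditive.comp_sum]
  simp only [evHom_comp]

variable (Λ) in
/-- The Nakayama functor `D Hom(-, Λ)` on objects. -/
abbrev nakayama (hI : IsEnvelopeOfSimples R I) (P : FinMod R Λᵐᵒᵖ) : FinMod R Λᵐᵒᵖ :=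
  (dualFunctor Λ hI).obj (op ((ringDual R Λ).obj (op P)))

/-- The Nakayama functor `D Hom(-, Λ)` on morphisms. -/
abbrev nakayamaMap (hI : IsEnvelopeOfSimples R I) {P Q : FinMod R Λᵐᵒᵖ} (h : P ⟶ Q) :
    nakayama Λ hI P ⟶ nakayama Λ hI Q :=
  (dualFunctor Λ hI).map ((ringDual R Λ).map h.op).op

/-- An element of `D X`, viewed as a functional. -/
def toFunctional {hI : IsEnvelopeOfSimples R I} {X : FinMod R Λ}
    (φ : (dualFunctor Λ hI).obj (op X)) : X →ₗ[R] I := φ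

/-- An element of `D Hom(P, Λ)` evaluated at a form. -/
def pairing {hI : IsEnvelopeOfSimples R I} {P : FinMod R Λᵐᵒᵖ} (φ : nakayama Λ hI P)
    (ξ : P →ₗ[Λᵐᵒᵖ] Λ) : I := toFunctional φ ξ

theorem pairing_nakayamaMap {hI : IsEnvelopeOfSimples R I} {P Q : FinMod R Λᵐᵒᵖ} (h : P ⟶ Q)
    (φ : nakayama Λ hI P) (ξ : Q →ₗ[Λᵐᵒᵖ] Λ) :
    pairing (FinMod.hom (nakayamaMap hI h) φ) ξ = pairing φ (ξ ∘ₗ FinMod.hom h) := rfl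

/-- The image of `R` in `Λ` is central, so a scalar may pass from the form to the value. -/
theorem evHom_smul_left {P Y : FinMod R Λᵐᵒᵖ} (r : R) (y : Y) (ξ : P →ₗ[Λᵐᵒᵖ] Λ) :
    evHom y (algebraMap R Λ r • ξ) = r • evHom y ξ :=
  FinMod.ext_hom (LinearMap.ext fun p => by
    change MulOpposite.op (algebraMap R Λ r * ξ p) • y =
      algebraMap R Λᵐᵒᵖ r • MulOpposite.op (ξ p) • y
    rw [← mul_smul, MulOpposite.op_mul, MulOpposite.algebraMap_apply,
      ← MulOpposite.op_mul, ← MulOpposite.op_mul, Algebra.commutes])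

/-- The comparison `D Hom(P, Y) → Hom(Y, D Hom(P, Λ))`, `λ ↦ (y ↦ (ξ ↦ λ(p ↦ y ξ(p))))`. -/
def nakayamaHom (hI : IsEnvelopeOfSimples R I) (P Y : FinMod R Λᵐᵒᵖ) :
    ((P ⟶ Y) →ₗ[R] I) →ₗ[R] (Y ⟶ nakayama Λ hI P) where
  toFun l := FinMod.ofHom (X := Y) (Y := nakayama Λ hI P)
    { toFun := fun y => (show ((ringDual R Λ).obj (op P)) →ₗ[R] I from
        { toFun := fun ξ => l (evHom y ξ)
          map_add' := fun ξ ξ' => by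
            rw [← map_add]
            congr 1
            exact FinMod.ext_hom (LinearMap.ext fun p => add_smul _ _ _)
          map_smul' := fun r ξ => by
            rw [RingHom.id_apply, ← map_smul]
            exact congrArg l (evHom_smul_left r y ξ) })
      map_add' := fun y y' => LinearMap.ext fun ξ => by
        change l _ = l _ + l _
        rw [← map_add]
        congr 1
        exact FinMod.ext_hom (LinearMap.ext fun p => smul_add _ _ _)
      map_smul' := fun a y => LinearMap.ext fun (ξ : P →ₗ[Λᵐᵒᵖ] Λ) => by
        change l _ = l _
        congr 1
        refine FinMod.ext_hom (LinearMap.ext fun p => ?_)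
        change MulOpposite.op (ξ p) • a • y = MulOpposite.op (a.unop * ξ p) • y
        rw [← mul_smul]
        rfl }
  map_add' l l' := rfl
  map_smul' r l := FinMod.ext_hom (LinearMap.ext fun y => LinearMap.ext fun
      (ξ : P →ₗ[Λᵐᵒᵖ] Λ) => by
    change r • l (evHom y ξ) = l (evHom y (algebraMap R Λ r • ξ))
    rw [evHom_smul_left, map_smul])

theorem pairing_nakayamaHom (hI : IsEnvelopeOfSimples R I) {P Y : FinMod R Λᵐᵒᵖ}
    (l : (P ⟶ Y) →ₗ[R] I) (y : Y) (ξ : P →ₗ[Λᵐᵒᵖ] Λ) :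
    pairing (FinMod.hom (nakayamaHom hI P Y l) y) ξ = l (evHom y ξ) := rfl

theorem nakayama_ext {hI : IsEnvelopeOfSimples R I} {P Y : FinMod R Λᵐᵒᵖ}
    {a b : Y ⟶ nakayama Λ hI P}
    (h : ∀ y ξ, pairing (FinMod.hom a y) ξ = pairing (FinMod.hom b y) ξ) : a = b :=
  FinMod.ext_hom (LinearMap.ext fun y => LinearMap.ext fun ξ => h y ξ)

/-- A dual basis `(qᵢ, ξᵢ)` of `P` expresses every `f : P ⟶ Y` as the sum of the `evHom (f qᵢ) ξᵢ`.
A functional is therefore determined by its values on such morphisms, and the same expansion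
dictates the preimage of a given `α`. -/
theorem nakayamaHom_bijective (hI : IsEnvelopeOfSimples R I) (P Y : FinMod R Λᵐᵒᵖ)
    [Projective P] : Function.Bijective (nakayamaHom (Λ := Λ) hI P Y) := by
  obtain ⟨n, q, ξ, h⟩ := exists_dual_basis P
  constructor
  · rw [← LinearMap.ker_eq_bot, LinearMap.ker_eq_bot']
    intro l hl
    ext f
    rw [← Category.id_comp f, eq_sum_evHom h, map_sum]
    refine Finset.sum_eq_zero fun i _ => ?_
    rw [Category.id_comp, ← pairing_nakayamaHom hI, hl]
    rfl
  · intro α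
    refine ⟨{ toFun := fun f => ∑ i, pairing (FinMod.hom α (FinMod.hom f (q i))) (ξ i)
              map_add' := fun f g => ?_
              map_smul' := fun r f => ?_ }, nakayama_ext fun y ζ => ?_⟩
    · rw [← Finset.sum_add_distrib]
      refine Finset.sum_congr rfl fun i _ => ?_
      rw [FinMod.hom_add, LinearMap.add_apply, map_add]
      rfl
    · rw [RingHom.id_apply, Finset.smul_sum]
      refine Finset.sum_congr rfl fun i _ => ?_
      rw [FinMod.hom_smul, algebra_compatible_smul Λᵐᵒᵖ r, map_smul]
      exact (toFunctional (FinMod.hom α (FinMod.hom f (q i)))).map_smul r (ξ i)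
    · rw [pairing_nakayamaHom]
      change ∑ i, pairing (FinMod.hom α (MulOpposite.op (ζ (q i)) • y)) (ξ i) = _
      have h1 : ∀ i, pairing (FinMod.hom α (MulOpposite.op (ζ (q i)) • y)) (ξ i)
          = pairing (FinMod.hom α y) (ζ (q i) • ξ i) := fun i => by
        rw [map_smul]
        rfl
      -- The dual basis identity of `P`, read on forms by applying `ζ` to it.
      have h2 : ∑ i, ζ (q i) • ξ i = ζ := LinearMap.ext fun p => by
        have := congrArg (fun f => ζ (FinMod.hom f p)) h
        beta_reduce at this
        rw [FinMod.hom_sum, map_sum] at this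
        rw [LinearMap.sum_apply]
        refine Eq.trans (Finset.sum_congr rfl fun i _ => ?_) this
        rw [hom_evHom, map_smul]
        rfl
      rw [Finset.sum_congr rfl fun i _ => h1 i]
      exact (map_sum (toFunctional (FinMod.hom α y)) (fun i => ζ (q i) • ξ i) Finset.univ).symm.trans
        (congrArg (pairing (FinMod.hom α y)) h2)

/-- For projective `P` the comparison `D Hom(P, Y) → Hom(Y, D Hom(P, Λ))` is an isomorphism. -/
def nakayamaEquiv (hI : IsEnvelopeOfSimples R I) (P Y : FinMod R Λᵐᵒᵖ) [Projective P] :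
    ((P ⟶ Y) →ₗ[R] I) ≃ₗ[R] (Y ⟶ nakayama Λ hI P) :=
  LinearEquiv.ofBijective _ (nakayamaHom_bijective hI P Y)

theorem nakayamaEquiv_symm_evHom (hI : IsEnvelopeOfSimples R I) {P Y : FinMod R Λᵐᵒᵖ}
    [Projective P] (α : Y ⟶ nakayama Λ hI P) (y : Y) (ξ : P →ₗ[Λᵐᵒᵖ] Λ) :
    (nakayamaEquiv hI P Y).symm α (evHom y ξ) = pairing (FinMod.hom α y) ξ := by
  conv_rhs => rw [← (nakayamaEquiv hI P Y).apply_symm_apply α]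
  rfl

/-- Naturality in the projective variable. It is definitional for the explicit comparison map and
passes to the inverse by writing `α` as an image. -/
theorem nakayamaEquiv_symm_comp_map (hI : IsEnvelopeOfSimples R I) {P Q Y : FinMod R Λᵐᵒᵖ}
    [Projective P] [Projective Q] (α : Y ⟶ nakayama Λ hI P) (h : P ⟶ Q) (f : Q ⟶ Y) :
    (nakayamaEquiv hI Q Y).symm (α ≫ nakayamaMap hI h) f
      = (nakayamaEquiv hI P Y).symm α (h ≫ f) := by
  obtain ⟨l, rfl⟩ := (nakayamaEquiv hI P Y).surjective α
  have : nakayamaEquiv hI P Y l ≫ nakayamaMap hI h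
      = nakayamaEquiv hI Q Y (l ∘ₗ Linear.leftComp R Y h) := rfl
  rw [this, LinearEquiv.symm_apply_apply, LinearEquiv.symm_apply_apply]
  rfl

theorem nakayamaEquiv_symm_comp (hI : IsEnvelopeOfSimples R I) {P Y Y' : FinMod R Λᵐᵒᵖ}
    [Projective P] (α : Y ⟶ nakayama Λ hI P) (g : Y' ⟶ Y) (f : P ⟶ Y') :
    (nakayamaEquiv hI P Y').symm (g ≫ α) f = (nakayamaEquiv hI P Y).symm α (f ≫ g) := by
  obtain ⟨l, rfl⟩ := (nakayamaEquiv hI P Y).surjective α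
  have : g ≫ nakayamaEquiv hI P Y l
      = nakayamaEquiv hI P Y' (l ∘ₗ Linear.rightComp R P g) :=
    nakayama_ext fun y ξ => congrArg l (evHom_comp g y ξ).symm
  rw [this, LinearEquiv.symm_apply_apply, LinearEquiv.symm_apply_apply]
  rfl

end Nakayama

/-! ### Connecting morphisms of short exact sequences with injective middle term -/

section Connecting

variable {C : Type u} [Category.{v} C] [Abelian C] [HasExt.{w} C]
  (R : Type t) [CommRing R] [Linear R C] {S : ShortComplex C} (hS : S.ShortExact)

/-- The connecting homomorphism `Hom(Y, X₃) → Ext¹(Y, X₁)` of a short exact sequence. -/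
def connecting (Y : C) : (Y ⟶ S.X₃) →ₗ[R] Ext.{w} Y S.X₁ 1 :=
  hS.extClass.postcompOfLinear R Y (zero_add 1) ∘ₗ (Ext.linearEquiv₀ (R := R)).symm.toLinearMap

theorem connecting_apply {Y : C} (f : Y ⟶ S.X₃) :
    connecting R hS Y f = (Ext.mk₀ f).comp hS.extClass (zero_add 1) := rfl

/-- The obstruction to lifting a class lies in `Extⁿ⁺¹(Y, X₂)`, which vanishes. This includes `n =
0`. -/
theorem postcomp_extClass_surjective [Injective S.X₂] (Y : C) (n : ℕ) :
    Function.Surjective (hS.extClass.postcompOfLinear R Y (rfl : n + 1 = n + 1)) := fun e =>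
  Ext.covariant_sequence_exact₁ Y hS e (Ext.eq_zero_of_injective _) rfl

/-- The source has positive degree, so its kernel, the image of `Extⁿ⁺¹(Y, X₂)`, vanishes too. In
degree zero `Hom(Y, X₂)` would survive. -/
theorem postcomp_extClass_bijective [Injective S.X₂] (Y : C) (n : ℕ) :
    Function.Bijective (hS.extClass.postcompOfLinear R Y (rfl : n + 1 + 1 = n + 2)) := by
  refine ⟨?_, postcomp_extClass_surjective R hS Y (n + 1)⟩
  rw [← LinearMap.ker_eq_bot, LinearMap.ker_eq_bot']
  intro e he
  obtain ⟨x, rfl⟩ := Ext.covariant_sequence_exact₃ Y hS e rfl he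
  rw [Ext.eq_zero_of_injective x, Ext.zero_comp]

theorem connecting_surjective [Injective S.X₂] (Y : C) :
    Function.Surjective (connecting R hS Y) :=
  (postcomp_extClass_surjective R hS Y 0).comp (Ext.linearEquiv₀ (R := R)).symm.surjective

/-- Exactness of the long exact sequence at `Hom(Y, X₃)`. For injective `X₂` it presents `Ext¹(Y,
X₁)` as a quotient of `Hom(Y, X₃)`. -/
theorem connecting_eq_zero_iff {Y : C} (f : Y ⟶ S.X₃) :
    connecting R hS Y f = 0 ↔ ∃ g : Y ⟶ S.X₂, g ≫ S.g = f := by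
  rw [connecting_apply]
  constructor
  · intro h
    obtain ⟨x, hx⟩ := Ext.covariant_sequence_exact₃ Y hS _ _ h
    obtain ⟨g, rfl⟩ := (Ext.mk₀_bijective _ _).2 x
    exact ⟨g, (Ext.mk₀_bijective _ _).1 (by rw [← Ext.mk₀_comp_mk₀, hx])⟩
  · rintro ⟨g, rfl⟩
    rw [← Ext.mk₀_comp_mk₀_assoc, hS.comp_extClass, Ext.comp_zero]

theorem precomp_connecting {Y Y' : C} (h : Y' ⟶ Y) (f : Y ⟶ S.X₃) :
    (Ext.mk₀ h).comp (connecting R hS Y f) (zero_add 1) = connecting R hS Y' (h ≫ f) := by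
  rw [connecting_apply, connecting_apply, Ext.mk₀_comp_mk₀_assoc]

theorem connecting_comp {S' : ShortComplex C} (hS' : S'.ShortExact) (φ : S ⟶ S') {Y : C}
    (f : Y ⟶ S.X₃) :
    (connecting R hS Y f).comp (Ext.mk₀ φ.τ₁) (add_zero 1)
      = connecting R hS' Y (f ≫ φ.τ₃) := by
  rw [connecting_apply, connecting_apply, Ext.comp_assoc _ _ _ (zero_add 1) (add_zero 1) (by lia),
    ShortComplex.ShortExact.extClass_naturality hS hS' φ, Ext.mk₀_comp_mk₀_assoc]

end Connecting

/-! ### Projective presentations -/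

section Presentation

variable {C : Type u} [Category.{v} C] [Abelian C] [EnoughProjectives C]

theorem syz_shortExact (X : C) : (ShortComplex.mk _ _ (syzι_π X)).ShortExact where
  exact := ShortComplex.exact_kernel _

/-- `X` is the cokernel of `P₁ ⟶ P₀`, because `P₁` covers the syzygy. -/
theorem presD_comp_eq_zero_iff {X W : C} (g : Projective.over X ⟶ W) :
    presD X ≫ g = 0 ↔ ∃ h : X ⟶ W, Projective.π X ≫ h = g := by
  constructor
  · intro h
    rw [presD, Category.assoc] at h
    have h := zero_of_epi_comp _ h
    have hS := syz_shortExact X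
    have := hS.epi_g
    exact ⟨hS.exact.desc g h, hS.exact.g_desc g h⟩
  · rintro ⟨h, rfl⟩
    rw [← Category.assoc, presD_π, zero_comp]

end Presentation

/-! ### Functionals on stable morphisms -/

section StableHom

variable {C : Type u} [Category.{v} C] [Abelian C] {R : Type t} [CommRing R] [Linear R C]
  {I : Type w} [AddCommGroup I] [Module R I]

/-- A linear functional on morphisms that kills those factoring through a projective induces a
functional on stable morphisms. -/
def stableLift {X Y : C} (l : (X ⟶ Y) →ₗ[R] I) (hl : ∀ f : X ⟶ Y, projRel C f 0 → l f = 0) :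
    ((CategoryTheory.Quotient.functor (projRel C)).obj X ⟶
      (CategoryTheory.Quotient.functor (projRel C)).obj Y) →ₗ[R] I where
  toFun := Quot.lift l (fun f g h => by
    -- The quotient category divides by the closure of the relation under composition, which for a
    -- congruence is the relation itself.
    rw [HomRel.compClosure_eq_self] at h
    obtain ⟨P, hP, a, b, h⟩ := h
    rw [← sub_eq_zero, ← map_sub]
    exact hl _ ⟨P, hP, a, b, by rw [sub_zero, h]⟩)
  map_add' := by
    rintro ⟨f⟩ ⟨g⟩
    exact map_add l f g
  map_smul' := by
    rintro r ⟨f⟩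
    exact map_smul l r f

theorem stableLift_map {X Y : C} (l : (X ⟶ Y) →ₗ[R] I)
    (hl : ∀ f : X ⟶ Y, projRel C f 0 → l f = 0) (f : X ⟶ Y) :
    stableLift l hl ((CategoryTheory.Quotient.functor (projRel C)).map f) = l f := rfl

theorem stableFunctional_ext {X Y : C}
    {l l' : ((CategoryTheory.Quotient.functor (projRel C)).obj X ⟶
      (CategoryTheory.Quotient.functor (projRel C)).obj Y) →ₗ[R] I}
    (h : ∀ f : X ⟶ Y, l ((CategoryTheory.Quotient.functor (projRel C)).map f)
      = l' ((CategoryTheory.Quotient.functor (projRel C)).map f)) : l = l' :=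
  LinearMap.ext fun f => by
    obtain ⟨f, rfl⟩ := (CategoryTheory.Quotient.functor (projRel C)).map_surjective f
    exact h f

end StableHom

/-! ### Exactness of the duality -/

section Duality

variable {R : Type u} [CommRing R] [IsArtinianRing R] {I : Type u} [AddCommGroup I] [Module R I]
  {Λ : Type u} [Ring Λ] [Algebra R Λ] [Module.Finite R Λ] (hI : IsEnvelopeOfSimples R I)

theorem dual_map_injective {A B : FinMod R Λ} (f : A ⟶ B) [Epi f] :
    Function.Injective (FinMod.hom ((dualFunctor Λ hI).map f.op)) := fun φ ψ h =>
  LinearMap.ext fun b => by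
    obtain ⟨a, rfl⟩ := FinMod.surjective_of_epi f b
    exact LinearMap.congr_fun (f := toFunctional (FinMod.hom ((dualFunctor Λ hI).map f.op) φ)) h a

/-- The functional vanishes on `ker g`, which lies in the range of `f`, so injectivity of `I`
extends it along `g`. -/
theorem dual_map_exact {A B C : FinMod R Λ} (f : A ⟶ B) (g : B ⟶ C)
    (h : ∀ b, FinMod.hom g b = 0 → ∃ a, FinMod.hom f a = b) (φ : (dualFunctor Λ hI).obj (op B))
    (hφ : FinMod.hom ((dualFunctor Λ hI).map f.op) φ = 0) :
    ∃ χ, FinMod.hom ((dualFunctor Λ hI).map g.op) χ = φ := by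
  have := hI.injective
  obtain ⟨χ, hχ⟩ := exists_extension ((FinMod.hom g).restrictScalars R) (toFunctional φ)
    (fun b hb => by
      obtain ⟨a, rfl⟩ := h b hb
      exact LinearMap.congr_fun (f := toFunctional (FinMod.hom ((dualFunctor Λ hI).map f.op) φ)) hφ a)
  exact ⟨χ, LinearMap.ext hχ⟩

theorem dual_map_surjective {B C : FinMod R Λ} (g : B ⟶ C)
    (hg : Function.Injective (FinMod.hom g)) :
    Function.Surjective (FinMod.hom ((dualFunctor Λ hI).map g.op)) := fun φ =>
  -- Since `g` has zero kernel, the zero endomorphism of `B` makes the sequence exact at `B`.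
  dual_map_exact hI (0 : B ⟶ B) g (fun b hb => ⟨0, by rw [map_zero, hg (hb.trans (map_zero _).symm)]⟩)
    φ (LinearMap.ext fun b => map_zero (toFunctional φ))

end Duality

/-! ### The case `d = 1` -/

section AuslanderReiten

variable {R : Type u} [CommRing R] [IsArtinianRing R] {I : Type u} [AddCommGroup I] [Module R I]
  {Λ : Type u} [Ring Λ] [Algebra R Λ] [Module.Finite R Λ] (hI : IsEnvelopeOfSimples R I)

variable (R Λ) in
/-- The algebra as a right module over itself. -/
abbrev regular : FinMod R Λᵐᵒᵖ := FinMod.of Λᵐᵒᵖ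

instance : Projective (regular R Λ) :=
  FinMod.projective_of_module (inferInstanceAs (Module.Projective Λᵐᵒᵖ Λᵐᵒᵖ))

/-- A form as a morphism to the regular module. -/
def formHom {P : FinMod R Λᵐᵒᵖ} (ξ : P →ₗ[Λᵐᵒᵖ] Λ) : P ⟶ regular R Λ :=
  FinMod.ofHom (Y := regular R Λ)
    { toFun := fun p => (MulOpposite.op (ξ p) : Λᵐᵒᵖ)
      map_add' := fun p q => by rw [map_add]; rfl
      map_smul' := fun a p => by rw [map_smul]; rfl }

/-- A morphism to the regular module as a form. -/
def homForm {P : FinMod R Λᵐᵒᵖ} (f : P ⟶ regular R Λ) : P →ₗ[Λᵐᵒᵖ] Λ where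
  toFun p := (show Λᵐᵒᵖ from FinMod.hom f p).unop
  map_add' p q := by rw [map_add]; rfl
  map_smul' a p := by rw [map_smul]; rfl

/-- The morphism factors as `p ↦ ξ(p)` followed by `a ↦ y a`, through the regular module. -/
theorem projRel_evHom {P Y : FinMod R Λᵐᵒᵖ} (y : Y) (ξ : P →ₗ[Λᵐᵒᵖ] Λ) :
    projRel _ (evHom y ξ) 0 :=
  ⟨regular R Λ, inferInstance, formHom ξ,
    FinMod.ofHom (X := regular R Λ) (LinearMap.toSpanSingleton Λᵐᵒᵖ Y y), sub_zero _⟩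

/-- The dual of the transpose. -/
abbrev tauObj (X : FinMod R Λᵐᵒᵖ) : FinMod R Λᵐᵒᵖ :=
  (dualFunctor Λ hI).obj (op (transposeObj (ringDual R Λ) X))

/-- The morphism between duals of transposes induced by the chosen lift of `f`. -/
abbrev tauMap {X X' : FinMod R Λᵐᵒᵖ} (f : X ⟶ X') : tauObj hI X ⟶ tauObj hI X' :=
  (dualFunctor Λ hI).map (transposeMap (ringDual R Λ) f).op

/-- The inclusion of `τ X` into `D Hom(P₁, Λ)`. -/
abbrev tauι (X : FinMod R Λᵐᵒᵖ) : tauObj hI X ⟶ nakayama Λ hI (Projective.over (syz X)) :=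
  (dualFunctor Λ hI).map (transposeπ (ringDual R Λ) X).op

theorem tauι_injective (X : FinMod R Λᵐᵒᵖ) : Function.Injective (FinMod.hom (tauι hI X)) :=
  dual_map_injective hI (transposeπ (ringDual R Λ) X)

instance (X : FinMod R Λᵐᵒᵖ) : Mono (tauι hI X) := FinMod.mono_of_injective _ (tauι_injective hI X)

theorem tauMap_ι {X X' : FinMod R Λᵐᵒᵖ} (f : X ⟶ X') :
    tauMap hI f ≫ tauι hI X' = tauι hI X ≫ nakayamaMap hI (lift₁ f) := by
  rw [← Functor.map_comp, ← op_comp, π_transposeMap, op_comp, Functor.map_comp]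

theorem tauι_nakayamaMap (X : FinMod R Λᵐᵒᵖ) : tauι hI X ≫ nakayamaMap hI (presD X) = 0 := by
  rw [← Functor.map_comp, ← op_comp, map_presD_transposeπ, op_zero, Functor.map_zero]

theorem exists_map_presD (X : FinMod R Λᵐᵒᵖ)
    (b : (ringDual R Λ).obj (op (Projective.over (syz X))))
    (hb : FinMod.hom (transposeπ (ringDual R Λ) X) b = 0) :
    ∃ a, FinMod.hom ((ringDual R Λ).map (presD X).op) a = b :=
  (FinMod.exact_iff (ShortComplex.mk _ _ (map_presD_transposeπ (ringDual R Λ) X))).1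
    (ShortComplex.exact_cokernel _) b hb

/-- `D` is applied to the exact sequence `Hom(P₀, Λ) ⟶ Hom(P₁, Λ) ⟶ Tr X`. Consequently the cokernel
of `τ X ⟶ ν P₁` embeds into `ν P₀`. -/
theorem tau_exact (X : FinMod R Λᵐᵒᵖ) :
    (ShortComplex.mk _ _ (tauι_nakayamaMap hI X)).Exact :=
  (FinMod.exact_iff _).2 fun φ hφ =>
    dual_map_exact hI _ (transposeπ (ringDual R Λ) X) (exists_map_presD X) φ hφ

/-- The cokernel of `τ X ⟶ D Hom(P₁, Λ)`. -/
abbrev tauCoker (X : FinMod R Λᵐᵒᵖ) : FinMod R Λᵐᵒᵖ := cokernel (tauι hI X)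

/-- The embedding of the cokernel of `τ X ⟶ D Hom(P₁, Λ)` into `D Hom(P₀, Λ)`. -/
def tauCokerι (X : FinMod R Λᵐᵒᵖ) : tauCoker hI X ⟶ nakayama Λ hI (Projective.over X) :=
  cokernel.desc _ _ (tauι_nakayamaMap hI X)

theorem π_tauCokerι (X : FinMod R Λᵐᵒᵖ) :
    cokernel.π (tauι hI X) ≫ tauCokerι hI X = nakayamaMap hI (presD X) :=
  cokernel.π_desc _ _ _

instance (X : FinMod R Λᵐᵒᵖ) : Mono (tauCokerι hI X) := by
  have h := (ShortComplex.exact_iff_mono_cokernel_desc _).1 (tau_exact hI X)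
  exact h

theorem tauCoker_shortExact (X : FinMod R Λᵐᵒᵖ) :
    (ShortComplex.mk _ _ (cokernel.condition (tauι hI X))).ShortExact where
  exact := ShortComplex.exact_cokernel _

/-- The morphism between the cokernels induced by `f`. -/
def tauCokerMap {X X' : FinMod R Λᵐᵒᵖ} (f : X ⟶ X') : tauCoker hI X ⟶ tauCoker hI X' :=
  cokernel.map _ _ (tauMap hI f) (nakayamaMap hI (lift₁ f)) (tauMap_ι hI f).symm

theorem π_tauCokerMap {X X' : FinMod R Λᵐᵒᵖ} (f : X ⟶ X') :
    cokernel.π (tauι hI X) ≫ tauCokerMap hI f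
      = nakayamaMap hI (lift₁ f) ≫ cokernel.π (tauι hI X') :=
  cokernel.π_desc _ _ _

/-- The map of cokernels is defined by the lift in degree one. Seen inside `ν P₀` it is given by the
lift in degree zero, which is what acts on functionals on `Hom(P₀, Y)`. -/
theorem tauCokerMap_ι {X X' : FinMod R Λᵐᵒᵖ} (f : X ⟶ X') :
    tauCokerMap hI f ≫ tauCokerι hI X' = tauCokerι hI X ≫ nakayamaMap hI (lift₀ f) := by
  rw [← cancel_epi (cokernel.π (tauι hI X)), ← Category.assoc, π_tauCokerMap, Category.assoc,
    π_tauCokerι, ← Category.assoc, π_tauCokerι, ← Functor.map_comp, ← op_comp, ← Functor.map_comp,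
    ← op_comp, lift₁_presD, op_comp, Functor.map_comp, op_comp, Functor.map_comp]

instance (P : FinMod R Λᵐᵒᵖ) [Projective P] : Injective (nakayama Λ hI P) :=
  dual_injective hI _ (ringDual_projective R Λ P inferInstance)

/-- The functional on `Hom(X, Y)` that corresponds to a morphism from `Y` to the cokernel of
`τ X ⟶ D Hom(P₁, Λ)`. -/
def cokerFunctional (X Y : FinMod R Λᵐᵒᵖ) : (Y ⟶ tauCoker hI X) →ₗ[R] ((X ⟶ Y) →ₗ[R] I) :=
  LinearMap.lcomp R I (Linear.leftComp R Y (Projective.π X)) ∘ₗ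
    (nakayamaEquiv hI (Projective.over X) Y).symm.toLinearMap ∘ₗ
      Linear.rightComp R Y (tauCokerι hI X)

theorem cokerFunctional_apply {X Y : FinMod R Λᵐᵒᵖ} (ψ : Y ⟶ tauCoker hI X) (f : X ⟶ Y) :
    cokerFunctional hI X Y ψ f
      = (nakayamaEquiv hI (Projective.over X) Y).symm (ψ ≫ tauCokerι hI X)
          (Projective.π X ≫ f) := rfl

/-- Elements of the cokernel come from `ν P₁` by precomposing forms with `P₁ ⟶ P₀`, and `P₁ ⟶ P₀ ⟶
X` is zero. -/
theorem pairing_tauCokerι {X : FinMod R Λᵐᵒᵖ} (k : tauCoker hI X)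
    (ξ : X →ₗ[Λᵐᵒᵖ] Λ) :
    pairing (FinMod.hom (tauCokerι hI X) k) (ξ ∘ₗ FinMod.hom (Projective.π X)) = 0 := by
  obtain ⟨φ, rfl⟩ := FinMod.surjective_of_epi (cokernel.π (tauι hI X)) k
  rw [← FinMod.hom_comp_apply, π_tauCokerι, pairing_nakayamaMap, LinearMap.comp_assoc,
    ← FinMod.hom_comp, presD_π]
  have : ξ ∘ₗ FinMod.hom (0 : Projective.over (syz X) ⟶ X) = 0 :=
    LinearMap.ext fun p => map_zero ξ
  rw [this]
  exact map_zero (toFunctional φ)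

/-- A morphism through a projective is a sum of `evHom`s whose forms are defined on all of `X`, and
`pairing_tauCokerι` kills these. -/
theorem cokerFunctional_eq_zero {X Y : FinMod R Λᵐᵒᵖ} (ψ : Y ⟶ tauCoker hI X) (f : X ⟶ Y)
    (hf : projRel _ f 0) : cokerFunctional hI X Y ψ f = 0 := by
  obtain ⟨Q, hQ, a, b, h⟩ := hf
  rw [sub_zero] at h
  obtain ⟨n, q, ξ, hq⟩ := exists_dual_basis Q
  rw [h, eq_sum_evHom hq, map_sum]
  refine Finset.sum_eq_zero fun i _ => ?_
  rw [cokerFunctional_apply, comp_evHom, comp_evHom, nakayamaEquiv_symm_evHom,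
    FinMod.hom_comp_apply, pairing_tauCokerι]

/-- The functional on stable morphisms that corresponds to a morphism from `Y` to the cokernel of
`τ X ⟶ D Hom(P₁, Λ)`. -/
def stableFunctional (X Y : FinMod R Λᵐᵒᵖ) :
    (Y ⟶ tauCoker hI X) →ₗ[R] (((CategoryTheory.Quotient.functor (projRel (FinMod R Λᵐᵒᵖ))).obj X ⟶
      (CategoryTheory.Quotient.functor (projRel _)).obj Y) →ₗ[R] I) where
  toFun ψ := stableLift (cokerFunctional hI X Y ψ) (cokerFunctional_eq_zero hI ψ)
  map_add' ψ ψ' := stableFunctional_ext fun f => by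
    rw [LinearMap.add_apply, stableLift_map, stableLift_map, stableLift_map, map_add]
    rfl
  map_smul' r ψ := stableFunctional_ext fun f => by
    rw [LinearMap.smul_apply, stableLift_map, stableLift_map, map_smul]
    rfl

theorem stableFunctional_map {X Y : FinMod R Λᵐᵒᵖ} (ψ : Y ⟶ tauCoker hI X) (f : X ⟶ Y) :
    stableFunctional hI X Y ψ ((CategoryTheory.Quotient.functor (projRel _)).map f)
      = (nakayamaEquiv hI (Projective.over X) Y).symm (ψ ≫ tauCokerι hI X)
          (Projective.π X ≫ f) := rfl

/-- If the functional on `Hom(P₀, Y)` kills everything that factors through `X`, it kills the kernel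
of `Hom(P₀, Y) ⟶ Hom(P₁, Y)`. It then extends to `Hom(P₁, Y)`, and the extension is a lift `Y ⟶ ν
P₁`. -/
theorem stableFunctional_eq_zero_iff {X Y : FinMod R Λᵐᵒᵖ} (ψ : Y ⟶ tauCoker hI X) :
    stableFunctional hI X Y ψ = 0 ↔ ∃ g, g ≫ cokernel.π (tauι hI X) = ψ := by
  constructor
  · intro h
    have := hI.injective
    obtain ⟨χ, hχ⟩ := exists_extension (Linear.leftComp R Y (presD X))
      ((nakayamaEquiv hI (Projective.over X) Y).symm (ψ ≫ tauCokerι hI X)) (fun b hb => by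
        obtain ⟨f, rfl⟩ := (presD_comp_eq_zero_iff b).1 hb
        rw [← stableFunctional_map, h]
        rfl)
    refine ⟨nakayamaEquiv hI _ Y χ, ?_⟩
    rw [← cancel_mono (tauCokerι hI X), Category.assoc, π_tauCokerι]
    refine (nakayamaEquiv hI (Projective.over X) Y).symm.injective (LinearMap.ext fun b => ?_)
    rw [nakayamaEquiv_symm_comp_map, LinearEquiv.symm_apply_apply]
    exact hχ b
  · rintro ⟨g, rfl⟩
    refine stableFunctional_ext fun f => ?_
    rw [stableFunctional_map, Category.assoc, π_tauCokerι, nakayamaEquiv_symm_comp_map,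
      ← Category.assoc, presD_π, zero_comp, map_zero]
    rfl

theorem stableFunctional_surjective (X Y : FinMod R Λᵐᵒᵖ) :
    Function.Surjective (stableFunctional hI X Y) := by
  intro μ
  have := hI.injective
  -- `Hom(X, Y)` embeds into `Hom(P₀, Y)`, so the given functional extends to one on `Hom(P₀, Y)`,
  -- that is, to a morphism `Y ⟶ ν P₀`.
  obtain ⟨l, hl⟩ := exists_extension (Linear.leftComp R Y (Projective.π X))
    (μ ∘ₗ (CategoryTheory.Quotient.functor (projRel _)).mapLinearMap R) (fun f hf => by
      have : f = 0 := zero_of_epi_comp (Projective.π X) hf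
      rw [this, map_zero])
  -- This morphism lands in the cokernel: its value at `y` vanishes on forms that extend over `X`,
  -- because `evHom y ζ` is stably zero. Exactness of `ν P₁ ⟶ ν P₀ ⟶ D Hom(X, Λ)` then gives a
  -- preimage.
  have hex : ∀ y, ∃ k, FinMod.hom (tauCokerι hI X) k
      = FinMod.hom (nakayamaEquiv hI (Projective.over X) Y l) y := fun y => by
    obtain ⟨χ, hχ⟩ := dual_map_exact hI ((ringDual R Λ).map (Projective.π X).op)
      ((ringDual R Λ).map (presD X).op) (fun ξ hξ => by
        obtain ⟨ζ, hζ⟩ := (presD_comp_eq_zero_iff (formHom (P := Projective.over X) ξ)).1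
          (congrArg (formHom (P := Projective.over (syz X))) hξ)
        exact ⟨homForm ζ, congrArg homForm hζ⟩)
      (FinMod.hom (nakayamaEquiv hI (Projective.over X) Y l) y)
      (LinearMap.ext fun (ζ : X →ₗ[Λᵐᵒᵖ] Λ) => by
        change l (Projective.π X ≫ evHom y ζ) = 0
        refine (hl _).trans ?_
        change μ ((CategoryTheory.Quotient.functor (projRel _)).map (evHom y ζ)) = 0
        rw [CategoryTheory.Quotient.sound _ (projRel_evHom y ζ), Functor.map_zero, map_zero])
    exact ⟨FinMod.hom (cokernel.π (tauι hI X)) χ, by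
      rw [← FinMod.hom_comp_apply, π_tauCokerι, hχ]⟩
  obtain ⟨ψ, hψ⟩ := FinMod.exists_fac_of_mono _ _ hex
  refine ⟨ψ, stableFunctional_ext fun f => ?_⟩
  rw [stableFunctional_map, hψ, LinearEquiv.symm_apply_apply]
  exact hl f

/-- Auslander–Reiten duality `Ext¹(Y, τ X) ≃ D (stable Hom(X, Y))`. -/
def arEquiv (X Y : FinMod R Λᵐᵒᵖ) :
    Ext.{u} Y (tauObj hI X) 1 ≃ₗ[R]
      (((CategoryTheory.Quotient.functor (projRel (FinMod R Λᵐᵒᵖ))).obj X ⟶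
        (CategoryTheory.Quotient.functor (projRel _)).obj Y) →ₗ[R] I) :=
  ((connecting R (tauCoker_shortExact hI X) Y).quotKerEquivOfSurjective
      (connecting_surjective R (tauCoker_shortExact hI X) Y)).symm ≪≫ₗ
    -- Both surjections from `Hom(Y, tauCoker)` have as kernel the morphisms that lift to `ν P₁`.
    Submodule.quotEquivOfEq _ (LinearMap.ker (stableFunctional hI X Y)) (by
      ext ψ
      rw [LinearMap.mem_ker, LinearMap.mem_ker, stableFunctional_eq_zero_iff,
        connecting_eq_zero_iff]) ≪≫ₗ
    (stableFunctional hI X Y).quotKerEquivOfSurjective (stableFunctional_surjective hI X Y)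

theorem arEquiv_connecting {X Y : FinMod R Λᵐᵒᵖ} (ψ : Y ⟶ tauCoker hI X) :
    arEquiv hI X Y (connecting R (tauCoker_shortExact hI X) Y ψ) = stableFunctional hI X Y ψ := by
  rw [arEquiv, LinearEquiv.trans_apply, LinearEquiv.trans_apply,
    ← LinearMap.quotKerEquivOfSurjective_apply_mk _
      (connecting_surjective R (tauCoker_shortExact hI X) Y), LinearEquiv.symm_apply_apply]
  rfl

theorem arEquiv_precomp {X Y Y' : FinMod R Λᵐᵒᵖ} (g : Y' ⟶ Y) (e : Ext.{u} Y (tauObj hI X) 1)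
    (f : (CategoryTheory.Quotient.functor (projRel (FinMod R Λᵐᵒᵖ))).obj X ⟶
      (CategoryTheory.Quotient.functor (projRel _)).obj Y') :
    arEquiv hI X Y' ((Ext.mk₀ g).comp e (zero_add 1)) f
      = arEquiv hI X Y e (f ≫ (CategoryTheory.Quotient.functor (projRel _)).map g) := by
  obtain ⟨ψ, rfl⟩ := connecting_surjective R (tauCoker_shortExact hI X) Y e
  obtain ⟨f, rfl⟩ := (CategoryTheory.Quotient.functor (projRel _)).map_surjective f
  rw [precomp_connecting, arEquiv_connecting, arEquiv_connecting, ← Functor.map_comp,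
    stableFunctional_map, stableFunctional_map, Category.assoc, nakayamaEquiv_symm_comp,
    Category.assoc]

/-- The lifts of `g` form a morphism of short exact sequences. Naturality of the extension class
reduces the claim to the cokernels, where `lift₀` lies over `g`. -/
theorem arEquiv_postcomp {X X' Y : FinMod R Λᵐᵒᵖ} (g : X ⟶ X') (e : Ext.{u} Y (tauObj hI X) 1)
    (f : (CategoryTheory.Quotient.functor (projRel (FinMod R Λᵐᵒᵖ))).obj X' ⟶
      (CategoryTheory.Quotient.functor (projRel _)).obj Y) :
    arEquiv hI X' Y (e.comp (Ext.mk₀ (tauMap hI g)) (add_zero 1)) f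
      = arEquiv hI X Y e ((CategoryTheory.Quotient.functor (projRel _)).map g ≫ f) := by
  obtain ⟨ψ, rfl⟩ := connecting_surjective R (tauCoker_shortExact hI X) Y e
  obtain ⟨f, rfl⟩ := (CategoryTheory.Quotient.functor (projRel _)).map_surjective f
  let φ : ShortComplex.mk _ _ (cokernel.condition (tauι hI X)) ⟶
      ShortComplex.mk _ _ (cokernel.condition (tauι hI X')) :=
    { τ₁ := tauMap hI g
      τ₂ := nakayamaMap hI (lift₁ g)
      τ₃ := tauCokerMap hI g
      comm₁₂ := tauMap_ι hI g
      comm₂₃ := (π_tauCokerMap hI g).symm }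
  have h := connecting_comp R (tauCoker_shortExact hI X) (tauCoker_shortExact hI X') φ ψ
  refine (congrArg (fun e => arEquiv hI X' Y e _) h).trans ?_
  rw [arEquiv_connecting, arEquiv_connecting, ← Functor.map_comp, stableFunctional_map,
    stableFunctional_map, Category.assoc]
  change (nakayamaEquiv hI _ Y).symm (ψ ≫ tauCokerMap hI g ≫ tauCokerι hI X') _ = _
  rw [tauCokerMap_ι, ← Category.assoc, nakayamaEquiv_symm_comp_map, ← Category.assoc, lift₀_π,
    Category.assoc]

end AuslanderReiten

/-! ### Vanishing of Ext on syzygies -/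

section ExtSyzygy

variable {C : Type u} [Category.{v} C] [Abelian C] [EnoughProjectives C] [HasExt.{w} C]

/-- If `Ext¹(Z, W)` vanishes, morphisms from the syzygy of `Z` to `W` extend to the projective. -/
theorem exists_extension_of_ext_one {Z W : C} [Subsingleton (Ext.{w} Z W 1)] (h : syz Z ⟶ W) :
    ∃ k : Projective.over Z ⟶ W, syzι Z ≫ k = h := by
  obtain ⟨x, hx⟩ := Ext.contravariant_sequence_exact₁ (syz_shortExact Z) W (Ext.mk₀ h) (add_zero 1)
    (Subsingleton.elim _ _)
  obtain ⟨k, rfl⟩ := (Ext.mk₀_bijective _ _).2 x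
  exact ⟨k, (Ext.mk₀_bijective _ _).1 (by rw [← Ext.mk₀_comp_mk₀]; exact hx)⟩

/-- The connecting map `Extᵏ⁺¹(Ω Z, W) ⟶ Extᵏ⁺²(Z, W)` is injective, since positive Ext out of the
projective cover term vanishes. -/
theorem subsingleton_ext_syz {Z W : C} (k : ℕ) (h : Subsingleton (Ext.{w} Z W (k + 2))) :
    Subsingleton (Ext.{w} (syz Z) W (k + 1)) := by
  refine subsingleton_of_forall_eq 0 fun e => ?_
  obtain ⟨x, rfl⟩ := Ext.contravariant_sequence_exact₁ (syz_shortExact Z) W e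
    (add_comm 1 (k + 1)) (Subsingleton.elim _ _)
  have : x = 0 := Ext.eq_zero_of_projective (P := Projective.over Z) x
  rw [this, Ext.comp_zero]

theorem subsingleton_ext_iteratedSyzygy {X W : C} (n k : ℕ)
    (h : Subsingleton (Ext.{w} X W (k + 1 + n))) :
    Subsingleton (Ext.{w} ((iteratedSyzygy C n).obj
      ((CategoryTheory.Quotient.functor (projRel C)).obj X)).as W (k + 1)) := by
  induction n generalizing k with
  | zero => exact h
  | succ n ih =>
    exact subsingleton_ext_syz (Z := ((iteratedSyzygy C n).obj
      ((CategoryTheory.Quotient.functor (projRel C)).obj X)).as) k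
      (ih (k + 1) (by rwa [show k + 1 + 1 + n = k + 1 + (n + 1) by lia]))

end ExtSyzygy

/-! ### The dimension shift -/

section TransposeSyzygy

variable {C : Type u} [Category.{v} C] [Abelian C] [EnoughProjectives C]
  {D : Type w} [Category.{t} D] [Abelian D] (F : Cᵒᵖ ⥤ D) [F.Additive]

/-- The morphism `Tr Z ⟶ F(P₂)` induced by the differential `P₂ ⟶ P₁`. -/
def transposeToDual (Z : C) :
    transposeObj F Z ⟶ F.obj (op (Projective.over (syz (syz Z)))) :=
  cokernel.desc _ (F.map (presD (syz Z)).op) (by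
    rw [← F.map_comp, ← op_comp, presD.eq_def Z, ← Category.assoc, presD_π, zero_comp, op_zero,
      F.map_zero])

theorem π_transposeToDual (Z : C) :
    transposeπ F Z ≫ transposeToDual F Z = F.map (presD (syz Z)).op :=
  cokernel.π_desc _ _ _

theorem transposeToDual_π (Z : C) : transposeToDual F Z ≫ transposeπ F (syz Z) = 0 := by
  rw [← cancel_epi (transposeπ F Z), ← Category.assoc, π_transposeToDual, map_presD_transposeπ,
    comp_zero]

/-- The chosen lift of `syzMap f` in degree one is a lift of `f` in degree two; it provides the
middle component in `shiftEquiv_postcomp`. -/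
theorem transposeMap_toDual {Z Z' : C} (f : Z ⟶ Z') :
    transposeMap F f ≫ transposeToDual F Z
      = transposeToDual F Z' ≫ F.map (lift₁ (syzMap f)).op := by
  rw [← cancel_epi (transposeπ F Z'), ← Category.assoc, π_transposeMap, Category.assoc,
    π_transposeToDual, ← Category.assoc, π_transposeToDual, ← F.map_comp, ← op_comp, ← F.map_comp,
    ← op_comp, lift₁_presD]
  rfl

end TransposeSyzygy

section Shift

variable {R : Type u} [CommRing R] [IsArtinianRing R] {I : Type u} [AddCommGroup I] [Module R I]
  {Λ : Type u} [Ring Λ] [Algebra R Λ] [Module.Finite R Λ] (hI : IsEnvelopeOfSimples R I)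

/-- A form on `P₁` that dies on `P₂` factors through `Ω Z`. As `Ext¹(Z, Λ) = 0`, it extends from
there to `P₀`, so its class in `Tr Z` is zero. -/
theorem transposeToDual_injective (Z : FinMod R Λᵐᵒᵖ) [Subsingleton (Ext.{u} Z (regular R Λ) 1)] :
    Function.Injective (FinMod.hom (transposeToDual (ringDual R Λ) Z)) := by
  refine (injective_iff_map_eq_zero _).2 fun t ht => ?_
  obtain ⟨ξ, rfl⟩ := FinMod.surjective_of_epi (transposeπ (ringDual R Λ) Z) t
  rw [← FinMod.hom_comp_apply, π_transposeToDual] at ht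
  obtain ⟨h, hh⟩ := (presD_comp_eq_zero_iff (formHom (P := Projective.over (syz Z)) ξ)).1
    (congrArg (formHom (P := Projective.over (syz (syz Z)))) ht)
  obtain ⟨k, rfl⟩ := exists_extension_of_ext_one h
  have hξ : ξ = FinMod.hom ((ringDual R Λ).map (presD Z).op) (homForm k) :=
    (congrArg homForm hh).symm
  rw [hξ]
  exact LinearMap.congr_fun (congrArg FinMod.hom (map_presD_transposeπ (ringDual R Λ) Z))
    (homForm k)

/-- The projection `D Hom(P₂, Λ) ⟶ τ Z`. -/
abbrev tauπ (Z : FinMod R Λᵐᵒᵖ) :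
    nakayama Λ hI (Projective.over (syz (syz Z))) ⟶ tauObj hI Z :=
  (dualFunctor Λ hI).map (transposeToDual (ringDual R Λ) Z).op

theorem tauι_π (Z : FinMod R Λᵐᵒᵖ) : tauι hI (syz Z) ≫ tauπ hI Z = 0 := by
  rw [← Functor.map_comp, ← op_comp, transposeToDual_π, op_zero, Functor.map_zero]

/-- The dual of `0 ⟶ Tr Z ⟶ Hom(P₂, Λ) ⟶ Tr Ω Z ⟶ 0`, in which only injectivity on the left needs
the vanishing of Ext. -/
theorem tau_shortExact (Z : FinMod R Λᵐᵒᵖ) [Subsingleton (Ext.{u} Z (regular R Λ) 1)] :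
    (ShortComplex.mk _ _ (tauι_π hI Z)).ShortExact :=
  FinMod.shortExact_of _ (tauι_injective hI (syz Z))
    (fun φ hφ => dual_map_exact hI (transposeToDual (ringDual R Λ) Z)
      (transposeπ (ringDual R Λ) (syz Z)) (fun b hb => by
        obtain ⟨a, rfl⟩ := exists_map_presD (syz Z) b hb
        exact ⟨FinMod.hom (transposeπ (ringDual R Λ) Z) a, by
          rw [← FinMod.hom_comp_apply, π_transposeToDual]⟩) φ hφ)
    (dual_map_surjective hI _ (transposeToDual_injective Z))

/-- The dimension shift `Extⁿ⁺¹(Y, τ Z) ≃ Extⁿ⁺²(Y, τ Ω Z)` if `Ext¹(Z, Λ) = 0`. -/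
def shiftEquiv (Z Y : FinMod R Λᵐᵒᵖ) [Subsingleton (Ext.{u} Z (regular R Λ) 1)] (n : ℕ) :
    Ext.{u} Y (tauObj hI Z) (n + 1) ≃ₗ[R] Ext.{u} Y (tauObj hI (syz Z)) (n + 2) :=
  LinearEquiv.ofBijective _ (postcomp_extClass_bijective R (tau_shortExact hI Z) Y n)

theorem shiftEquiv_apply {Z Y : FinMod R Λᵐᵒᵖ} [Subsingleton (Ext.{u} Z (regular R Λ) 1)] {n : ℕ}
    (e : Ext.{u} Y (tauObj hI Z) (n + 1)) :
    shiftEquiv hI Z Y n e = e.comp (tau_shortExact hI Z).extClass rfl := rfl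

theorem shiftEquiv_precomp {Z Y Y' : FinMod R Λᵐᵒᵖ} [Subsingleton (Ext.{u} Z (regular R Λ) 1)]
    {n : ℕ} (g : Y' ⟶ Y) (e : Ext.{u} Y (tauObj hI Z) (n + 1)) :
    shiftEquiv hI Z Y' n ((Ext.mk₀ g).comp e (zero_add _))
      = (Ext.mk₀ g).comp (shiftEquiv hI Z Y n e) (zero_add _) := by
  rw [shiftEquiv_apply, shiftEquiv_apply]
  exact Ext.comp_assoc _ _ _ (by lia) (by lia) (by lia)

theorem shiftEquiv_postcomp {Z Z' Y : FinMod R Λᵐᵒᵖ} [Subsingleton (Ext.{u} Z (regular R Λ) 1)]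
    [Subsingleton (Ext.{u} Z' (regular R Λ) 1)] {n : ℕ} (g : Z ⟶ Z')
    (e : Ext.{u} Y (tauObj hI Z) (n + 1)) :
    shiftEquiv hI Z' Y n (e.comp (Ext.mk₀ (tauMap hI g)) (add_zero _))
      = (shiftEquiv hI Z Y n e).comp (Ext.mk₀ (tauMap hI (syzMap g))) (add_zero _) := by
  let φ : ShortComplex.mk _ _ (tauι_π hI Z) ⟶ ShortComplex.mk _ _ (tauι_π hI Z') :=
    { τ₁ := tauMap hI (syzMap g)
      τ₂ := nakayamaMap hI (lift₁ (syzMap g))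
      τ₃ := tauMap hI g
      comm₁₂ := tauMap_ι hI (syzMap g)
      comm₂₃ := by
        change nakayamaMap hI (lift₁ (syzMap g)) ≫ tauπ hI Z' = tauπ hI Z ≫ tauMap hI g
        rw [← Functor.map_comp, ← op_comp, ← transposeMap_toDual, op_comp, Functor.map_comp] }
  have h := ShortComplex.ShortExact.extClass_naturality (tau_shortExact hI Z)
    (tau_shortExact hI Z') φ
  rw [shiftEquiv_apply, shiftEquiv_apply]
  refine (Ext.comp_assoc _ _ _ (add_zero _) (zero_add 1) (by lia)).trans ?_
  refine Eq.trans ?_ (Ext.comp_assoc _ _ _ rfl (add_zero 1) (by lia)).symm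
  exact congrArg (fun x => e.comp x rfl) h.symm

end Shift

/-! ### Higher Auslander–Reiten duality -/

section Higher

variable {R : Type u} [CommRing R] [IsArtinianRing R] {I : Type u} [AddCommGroup I] [Module R I]
  {Λ : Type u} [Ring Λ] [Algebra R Λ] [Module.Finite R Λ] (hI : IsEnvelopeOfSimples R I)

/-- The translation `D Tr` from the projectively to the injectively stable category. -/
abbrev tauFunctor : ProjStable (FinMod R Λᵐᵒᵖ) ⥤ InjStable (FinMod R Λᵐᵒᵖ) :=
  transposeFunctor (ringDual R Λ) (ringDual_projective R Λ) ⋙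
    dualityStable (dualFunctor Λ hI) (dual_injective hI)

/-- A stable morphism is represented by a module homomorphism, on which the functor acts through
`tauMap`. -/
theorem arEquiv_map_tauFunctor {X X' : ProjStable (FinMod R Λᵐᵒᵖ)} {Y : FinMod R Λᵐᵒᵖ}
    (φ : X ⟶ X') (e : Ext.{u} Y (tauObj hI X.as) 1)
    (f : X' ⟶ (CategoryTheory.Quotient.functor (projRel _)).obj Y) :
    arEquiv hI X'.as Y (((extInjStable R 1 one_pos Y).map ((tauFunctor hI).map φ)).hom e) f
      = arEquiv hI X.as Y e (φ ≫ f) := by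
  obtain ⟨g, rfl⟩ := (CategoryTheory.Quotient.functor (projRel _)).map_surjective
    (X := X.as) (Y := X'.as) φ
  exact arEquiv_postcomp hI g e f

theorem shiftEquiv_map_tauFunctor {Z Z' : ProjStable (FinMod R Λᵐᵒᵖ)} {Y : FinMod R Λᵐᵒᵖ}
    [Subsingleton (Ext.{u} Z.as (regular R Λ) 1)] [Subsingleton (Ext.{u} Z'.as (regular R Λ) 1)]
    {n : ℕ} (φ : Z ⟶ Z') (e : Ext.{u} Y (tauObj hI Z.as) (n + 1)) :
    shiftEquiv hI Z'.as Y n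
        (((extInjStable R (n + 1) n.succ_pos Y).map ((tauFunctor hI).map φ)).hom e)
      = ((extInjStable R (n + 2) (n + 1).succ_pos Y).map
          ((tauFunctor hI).map ((syzygyFunctor _).map φ))).hom (shiftEquiv hI Z.as Y n e) := by
  obtain ⟨g, rfl⟩ := (CategoryTheory.Quotient.functor (projRel _)).map_surjective
    (X := Z.as) (Y := Z'.as) φ
  exact shiftEquiv_postcomp hI g e

variable (R Λ) in
/-- The modules `X` with `Extᵏ(X, Λ) = 0` for `0 < k ≤ n`. -/
def extPerp (n : ℕ) : ObjectProperty (ProjStable (FinMod R Λᵐᵒᵖ)) := fun X =>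
  ∀ k, k < n → Subsingleton (Ext.{u} X.as (regular R Λ) (k + 1))

theorem extPerp.of_succ {n : ℕ} {X : ProjStable (FinMod R Λᵐᵒᵖ)} (h : extPerp R Λ (n + 1) X) :
    extPerp R Λ n X := fun k hk => h k (by lia)

/-- Dimension shift: `Ext¹(Ωⁿ X, Λ)` is controlled by `Extⁿ⁺¹(X, Λ)`, the top degree covered by the
hypothesis. -/
theorem extPerp.subsingleton {n : ℕ} {X : ProjStable (FinMod R Λᵐᵒᵖ)}
    (h : extPerp R Λ (n + 1) X) :
    Subsingleton (Ext.{u} ((iteratedSyzygy _ n).obj X).as (regular R Λ) 1) :=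
  subsingleton_ext_iteratedSyzygy (X := X.as) n 0 (by
    rw [show 0 + 1 + n = n + 1 by lia]
    exact h n (by lia))

/-- Higher Auslander–Reiten duality `Extⁿ⁺¹(Y, τ Ωⁿ X) ≃ D (stable Hom(X, Y))` for modules `X`
with `Extᵏ(X, Λ) = 0` for `0 < k ≤ n`. -/
def higherEquiv : (n : ℕ) → (X : ProjStable (FinMod R Λᵐᵒᵖ)) → extPerp R Λ n X →
    (Y : FinMod R Λᵐᵒᵖ) →
    (Ext.{u} Y (tauObj hI ((iteratedSyzygy _ n).obj X).as) (n + 1) ≃ₗ[R]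
      ((X ⟶ (CategoryTheory.Quotient.functor (projRel _)).obj Y) →ₗ[R] I))
  | 0, X, _, Y => arEquiv hI X.as Y
  | n + 1, X, h, Y =>
    haveI := h.subsingleton
    (shiftEquiv hI ((iteratedSyzygy _ n).obj X).as Y n).symm ≪≫ₗ higherEquiv n X h.of_succ Y

/-- The recursive step without the inverse of the shift. The naturality proofs write each class as a
shifted one and then use this form. -/
theorem higherEquiv_shiftEquiv {n : ℕ} {X : ProjStable (FinMod R Λᵐᵒᵖ)}
    (h : extPerp R Λ (n + 1) X) {Y : FinMod R Λᵐᵒᵖ}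
    (e : Ext.{u} Y (tauObj hI ((iteratedSyzygy _ n).obj X).as) (n + 1)) :
    haveI := h.subsingleton
    higherEquiv hI (n + 1) X h Y (shiftEquiv hI ((iteratedSyzygy _ n).obj X).as Y n e)
      = higherEquiv hI n X h.of_succ Y e :=
  haveI := h.subsingleton
  congrArg (higherEquiv hI n X h.of_succ Y) (LinearEquiv.symm_apply_apply _ e)

theorem higherEquiv_precomp (n : ℕ) {X : ProjStable (FinMod R Λᵐᵒᵖ)} (h : extPerp R Λ n X)
    {Y Y' : FinMod R Λᵐᵒᵖ} (g : Y' ⟶ Y)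
    (e : Ext.{u} Y (tauObj hI ((iteratedSyzygy _ n).obj X).as) (n + 1))
    (f : X ⟶ (CategoryTheory.Quotient.functor (projRel _)).obj Y') :
    higherEquiv hI n X h Y' ((Ext.mk₀ g).comp e (zero_add _)) f
      = higherEquiv hI n X h Y e (f ≫ (CategoryTheory.Quotient.functor (projRel _)).map g) := by
  induction n with
  | zero => exact arEquiv_precomp hI g e f
  | succ n ih =>
    have := h.subsingleton
    obtain ⟨e, rfl⟩ := (shiftEquiv hI ((iteratedSyzygy _ n).obj X).as Y n).surjective e
    refine (LinearMap.congr_fun ((congrArg (higherEquiv hI (n + 1) X h Y')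
      (shiftEquiv_precomp hI g e).symm).trans (higherEquiv_shiftEquiv hI h _)) f).trans ?_
    rw [ih h.of_succ, higherEquiv_shiftEquiv]

theorem higherEquiv_map (n : ℕ) {X X' : ProjStable (FinMod R Λᵐᵒᵖ)} (h : extPerp R Λ n X)
    (h' : extPerp R Λ n X') {Y : FinMod R Λᵐᵒᵖ} (φ : X ⟶ X')
    (e : Ext.{u} Y (tauObj hI ((iteratedSyzygy _ n).obj X).as) (n + 1))
    (f : X' ⟶ (CategoryTheory.Quotient.functor (projRel _)).obj Y) :
    higherEquiv hI n X' h' Y (((extInjStable R (n + 1) n.succ_pos Y).map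
        ((tauFunctor hI).map ((iteratedSyzygy _ n).map φ))).hom e) f
      = higherEquiv hI n X h Y e (φ ≫ f) := by
  induction n with
  | zero => exact arEquiv_map_tauFunctor hI φ e f
  | succ n ih =>
    have := h.subsingleton
    have := h'.subsingleton
    obtain ⟨e, rfl⟩ := (shiftEquiv hI ((iteratedSyzygy _ n).obj X).as Y n).surjective e
    refine (LinearMap.congr_fun ((congrArg (higherEquiv hI (n + 1) X' h' Y)
      (shiftEquiv_map_tauFunctor hI ((iteratedSyzygy _ n).map φ) e).symm).trans
        (higherEquiv_shiftEquiv hI h' _)) f).trans ?_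
    rw [ih h.of_succ h'.of_succ, higherEquiv_shiftEquiv]

/-- `Λ` belongs to `M` because positive Ext out of a projective vanishes; then `X` in `M` is
Ext-orthogonal to `Λ` in degrees `1, …, n`. -/
theorem IsClusterTilting.extPerp {n : ℕ} {M : ObjectProperty (FinMod R Λᵐᵒᵖ)}
    (hM : IsClusterTilting (n + 1) M) {X : ProjStable (FinMod R Λᵐᵒᵖ)} (hX : M X.as) :
    extPerp R Λ n X := fun k hk =>
  (hM.mem_iff_left X.as).1 hX (k + 1) (by lia) (by lia) _ ((hM.mem_iff_left (regular R Λ)).2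
    fun j hj _ N _ => by
      obtain ⟨j, rfl⟩ : ∃ i, j = i + 1 := ⟨j - 1, by lia⟩
      exact subsingleton_of_forall_eq 0 fun e => Ext.eq_zero_of_projective e)

/-- Stable functionals on morphisms of a full subcategory. -/
def fullSubcategoryDual {M : ObjectProperty (FinMod R Λᵐᵒᵖ)} (X Y : StableSub M) :
    ((X.obj ⟶ Y.obj) →ₗ[R] I) ≃ₗ[R] ((X ⟶ Y) →ₗ[R] I) where
  toFun l :=
    { toFun := fun f => l f.hom
      map_add' := fun f g => map_add l f.hom g.hom
      map_smul' := fun r f => map_smul l r f.hom }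
  map_add' _ _ := rfl
  map_smul' _ _ := rfl
  invFun l :=
    { toFun := fun f => l ⟨f⟩
      map_add' := fun f g => map_add l ⟨f⟩ ⟨g⟩
      map_smul' := fun r f => map_smul l r ⟨f⟩ }
  left_inv _ := rfl
  right_inv _ := rfl

end Higher

end HigherAR

end

theorem mainTheorem6 {R : Type u} [CommRing R] [IsArtinianRing R]
    {I : Type u} [AddCommGroup I] [Module R I] (hI : HigherAR.IsEnvelopeOfSimples R I)
    {Λ : Type u} [Ring Λ] [Algebra R Λ] [Module.Finite R Λ]
    (d : ℕ) (hd : 0 < d) (M : ObjectProperty (HigherAR.FinMod R Λᵐᵒᵖ))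
    (hM : HigherAR.IsClusterTilting d M) :
    Nonempty (HigherAR.dualStableHom I M ≅ HigherAR.extTau hI d hd M) := by
  -- With `d = n + 1` the truncated exponent `d - 1` in `higherTau` reduces to `n`.
  obtain ⟨n, rfl⟩ : ∃ n, d = n + 1 := ⟨d - 1, by lia⟩
  let E (X Y : HigherAR.StableSub M) :=
    HigherAR.higherEquiv hI n X.obj (hM.extPerp X.property) Y.obj.as ≪≫ₗ
      HigherAR.fullSubcategoryDual X Y
  -- The equivalences run from Ext to the dual of stable morphisms, so the inverse isomorphism is
  -- the one constructed.
  refine ⟨Iso.symm (NatIso.ofComponents (fun X => NatIso.ofComponents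
    (fun Y => (E X Y.unop).toModuleIso) ?_) ?_)⟩
  · rintro ⟨Y⟩ ⟨Y'⟩ ⟨g : Y' ⟶ Y⟩
    -- Naturality in `Y` is known for module homomorphisms, so the stable morphism is replaced by a
    -- representative.
    obtain ⟨γ, hγ⟩ := (CategoryTheory.Quotient.functor (HigherAR.projRel _)).map_surjective
      (X := Y'.obj.as) (Y := Y.obj.as) g.hom
    obtain rfl : g = ⟨(CategoryTheory.Quotient.functor (HigherAR.projRel _)).map γ⟩ :=
      InducedCategory.hom_ext hγ.symm
    refine ModuleCat.hom_ext (LinearMap.ext fun e => LinearMap.ext fun f => ?_)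
    exact HigherAR.higherEquiv_precomp hI n (hM.extPerp X.property) γ e f.hom
  · intro X X' φ
    refine NatTrans.ext (funext fun Y => ModuleCat.hom_ext (LinearMap.ext fun e =>
      LinearMap.ext fun f => ?_))
    exact HigherAR.higherEquiv_map hI n (hM.extPerp X.property) (hM.extPerp X'.property) φ.hom e
      f.hom
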